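/- **Setting.** Let $\mathcal S,\mathcal A$ be Polish spaces with their Borel $\sigma$-algebras, $r:\mathcal S\times\mathcal A\to\mathbb R$ a bounded Borel reward, $P$ a stochastic (Markov) kernel from $\mathcal S\times\mathcal A$ to $\mathcal S$, $\gamma\in[0,1)$, and $\mu$ a stochastic kernel from $\mathcal S$ to $\mathcal A$ (the behavior policy). A budget-aware policy is a stochastic kernel $\pi(\cdot\mid s,b)$ from $\mathcal S\times\mathbb Z$ to $\mathcal A$. Under $\pi$ we have $a_t\sim\pi(\cdot\mid s_t,b_t)$, $s_{t+1}\sim P(\cdot\mid s_t,a_t)$, $r_t=r(s_t,a_t)$ and $$b_{t+1}=b_t-\mathbb 1\{\pi(\cdot\mid s_t,b_t)\neq\mu(\cdot\mid s_t)\}.$$ For $s\in\mathcal S$, $a\in\mathcal A$, $b\in\mathbb N=\{0,1,2,\dots\}$ let $$Q^\star(s,b,a)=\sup_\pi \mathbb E\Big[\sum_{t\ge 0}\gamma^t r_t\,\Big|\,s_0=s,a_0=a,b_1=b,\pi\Big]\quad\text{over all }\pi\text{ with } b_t\ge 0\text{ for all }t\ge 1\text{ almost surely},$$ $$V^\star(s,b)=\sup_\pi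 \mathbb E\Big[\sum_{t\ge 0}\gamma^t r_t\,\Big|\,s_0=s,b_0=b,\pi\Big]\quad\text{over all }\pi\text{ with } b_t\ge 0\text{ for all }t\ge 0\text{ almost surely}.$$ For a bounded $Q:\mathcal S\times\mathbb N\times\mathcal A\to\mathbb R$ the counterfactual-budgeting Bellman operator is $$\mathcal T_{\rm CB}Q(s,b,a)=r(s,a)+\gamma\,\mathbb E_{s'\sim P(\cdot\mid s,a)}[V_Q(s',b)],$$ $$V_Q(s,b)=\begin{cases}\max\{\sup_{a}Q(s,b-1,a),\ \mathbb E_{a\sim\mu(\cdot\mid s)}Q(s,b,a)\}& b>0,\\ \mathbb E_{a\sim\mu(\cdot\mid s)}Q(s,0,a)& b=0.\end{cases}$$ Let $\mathcal D$ be the set of bounded $Q$ for which all these expectations are of almost everywhere measurable functions (that is, $Q(s,b,\cdot)$ is $\mu(\cdot\mid s)$-measurable and $V_Q(\cdot,b)$ is $P(\cdot\mid s,a)$-measurable, up to null sets, for all $s,b,a$), and let $\mathcal Q$ be the set of bounded $Q$ such that $\{(s,a):Q(s,b,a)>c\}$ is an analytic set for all $b\in\mathbb N$, $c\in\mathbb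 R$. **Theorem.** 1. $\mathcal Q\subseteq\mathcal D$ and $\mathcal T_{\rm CB}$ maps $\mathcal Q$ into $\mathcal Q$. It is a $\gamma$-contraction in the sup norm: $\|\mathcal T_{\rm CB}Q_1-\mathcal T_{\rm CB}Q_2\|_\infty\le\gamma\|Q_1-Q_2\|_\infty$ for all $Q_1,Q_2\in\mathcal D$. 2. The sets of values in the definitions of $Q^\star$ and $V^\star$ are non-empty and bounded, so that these are genuine (finite) suprema. The function $Q^\star$ belongs to $\mathcal Q$, satisfies $\mathcal T_{\rm CB}Q^\star=Q^\star$, and is the only fixed point of $\mathcal T_{\rm CB}$ in $\mathcal D$ (in particular, the only one in $\mathcal Q$). 3. For all $s,b,a$, the function $V^\star(\cdot,b)$ is $P(\cdot\mid s,a)$-integrable, and $$Q^\star(s,b,a)=r(s,a)+\gamma\,\mathbb E_{s'\sim P(\cdot\mid s,a)}[V^\star(s',b)],$$ $$V^\star(s,b)=\begin{cases}\max\{\sup_a Q^\star(s,b-1,a),\ \mathbb E_{a\sim\mu(\cdot\mid s)}Q^\star(s,b,a)\}& b>0,\\ \mathbb E_{a\sim\mu(\cdot\mid s)}Q^\star(s,0,a)&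 b=0.\end{cases}$$ 4. If for all $s,b$ the supremum $\sup_aQ^\star(s,b,a)$ is attained (for example if $\mathcal A$ is finite), then the supremum over policies in the definition of $Q^\star(s,b,a)$ is attained for all $s,b,a$. -/

import Mathlib

open MeasureTheory ProbabilityTheory
open scoped ENNReal

noncomputable section

namespace CounterfactualBudget

/-- An infinite-horizon discounted Markov decision process with state space `S` and action space
`A`: a bounded measurable reward, a transition kernel and a discount factor in `[0, 1)`. (The
initial state distribution plays no role for the quantities below, which are all indexed by the
initial state.) -/
structure MDP (S A : Type*) [MeasurableSpace S] [MeasurableSpace A] where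
  reward : S × A → ℝ
  measurable_reward : Measurable reward
  bounded_reward : ∃ R : ℝ, ∀ x, |reward x| ≤ R
  transition : Kernel (S × A) S
  markov_transition : IsMarkovKernel transition
  γ : ℝ
  γ_nonneg : 0 ≤ γ
  γ_lt_one : γ < 1

attribute [instance] MDP.markov_transition

/-- A budget-aware policy `π(· | s, b)`: a stochastic kernel from states and current budgets to
actions. Budgets are integers, so that a policy may overspend; see `Feasible`. -/
structure Policy (S A : Type*) [MeasurableSpace S] [MeasurableSpace A] where
  kernel : Kernel (S × ℤ) A
  markov_kernel : IsMarkovKernel kernel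

attribute [instance] Policy.markov_kernel

section Measurability

variable {X A : Type*} [MeasurableSpace X] [MeasurableSpace A]

theorem measurableSet_kernel_eq [StandardBorelSpace A] (κ η : Kernel X A)
    [IsMarkovKernel κ] [IsMarkovKernel η] : MeasurableSet {x | κ x = η x} := by
  have he : MeasurableEmbedding (embeddingReal A) := measurableEmbedding_embeddingReal A
  have hset : {x | κ x = η x} =
      ⋂ q : ℚ, {x | κ x (embeddingReal A ⁻¹' Set.Iic (q : ℝ)) =
        η x (embeddingReal A ⁻¹' Set.Iic (q : ℝ))} := by
    ext x
    simp only [Set.mem_ofPred_eq, Set.mem_iInter]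
    refine ⟨fun h q => by rw [h], fun h => ?_⟩
    have hmap : (κ x).map (embeddingReal A) = (η x).map (embeddingReal A) := by
      have := Measure.isProbabilityMeasure_map (μ := κ x) he.measurable.aemeasurable
      have := Measure.isProbabilityMeasure_map (μ := η x) he.measurable.aemeasurable
      refine ext_of_generate_finite _ (BorelSpace.measurable_eq.trans
        Real.borel_eq_generateFrom_Iic_rat) Real.isPiSystem_Iic_rat ?_ (by simp)
      intro s hs
      simp only [Set.mem_iUnion, Set.mem_singleton_iff] at hs
      obtain ⟨q, rfl⟩ := hs
      rw [he.map_apply, he.map_apply]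
      exact h q
    rw [← he.comap_map (κ x), ← he.comap_map (η x), hmap]
  rw [hset]
  refine MeasurableSet.iInter fun q => measurableSet_eq_fun ?_ ?_
  · exact κ.measurable_coe (he.measurable measurableSet_Iic)
  · exact η.measurable_coe (he.measurable measurableSet_Iic)

end Measurability

variable {S A : Type*} [MeasurableSpace S] [MeasurableSpace A]

open Classical in
/-- The budget update `b - 𝟙{π(· | s, b) ≠ μ(· | s)}`. -/
def nextBudget (μ : Kernel S A) (π : Policy S A) (x : S × ℤ) : ℤ :=
  x.2 - if π.kernel x ≠ μ x.1 then 1 else 0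

theorem measurable_nextBudget [StandardBorelSpace A] (μ : Kernel S A) [IsMarkovKernel μ]
    (π : Policy S A) : Measurable (nextBudget μ π) := by
  classical
  unfold nextBudget
  refine measurable_snd.sub (Measurable.ite ?_ measurable_const measurable_const)
  exact (measurableSet_kernel_eq π.kernel (μ.comap Prod.fst measurable_fst)).compl

/-- One step of the controlled process. A point `((s, a), b)` records the current state
`s = s_t`, the current action `a = a_t` and the budget `b = b_{t+1}` that is left after that action.
Then `s_{t+1} ∼ P(· | s_t, a_t)`, `a_{t+1} ∼ π(· | s_{t+1}, b_{t+1})` and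
`b_{t+2} = b_{t+1} - 𝟙{π(· | s_{t+1}, b_{t+1}) ≠ μ(· | s_{t+1})}`. -/
def stepKernel [StandardBorelSpace A] (M : MDP S A) (μ : Kernel S A) [IsMarkovKernel μ]
    (π : Policy S A) : Kernel ((S × A) × ℤ) ((S × A) × ℤ) :=
  ((M.transition.comap (fun z : (S × A) × ℤ => z.1) measurable_fst) ⊗ₖ
    (π.kernel.comap (fun p : ((S × A) × ℤ) × S => (p.2, p.1.2))
      (measurable_snd.prodMk (measurable_snd.comp measurable_fst)))) ⊗ₖ
    Kernel.deterministic
      (fun q : ((S × A) × ℤ) × (S × A) => nextBudget μ π (q.2.1, q.1.2))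
      ((measurable_nextBudget μ π).comp
        ((measurable_fst.comp measurable_snd).prodMk (measurable_snd.comp measurable_fst)))

instance [StandardBorelSpace A] (M : MDP S A) (μ : Kernel S A) [IsMarkovKernel μ]
    (π : Policy S A) : IsMarkovKernel (stepKernel M μ π) := by
  unfold stepKernel
  infer_instance

/-- The law of the trajectory `t ↦ ((s_t, a_t), b_{t+1})` under the policy `π`, when
`((s_0, a_0), b_1)` has law `ρ`. -/
def trajLaw [StandardBorelSpace A] (M : MDP S A) (μ : Kernel S A) [IsMarkovKernel μ]
    (π : Policy S A) (ρ : Measure ((S × A) × ℤ)) : Measure (ℕ → (S × A) × ℤ) :=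
  Kernel.trajMeasure (X := fun _ => (S × A) × ℤ) ρ
    (fun n => (stepKernel M μ π).comap
      (fun h : (i : Finset.Iic n) → (S × A) × ℤ => h ⟨n, Finset.mem_Iic.2 le_rfl⟩)
      (measurable_pi_apply _))

/-- The law of `((s_0, a_0), b_1)` given `s_0 = s`, `b_0 = b` and `a_0 ∼ π(· | s_0, b_0)`. -/
def startLaw (μ : Kernel S A) (π : Policy S A) (s : S) (b : ℤ) : Measure ((S × A) × ℤ) :=
  (π.kernel (s, b)).map (fun a => ((s, a), nextBudget μ π (s, b)))

/-- The expected discounted return `E[∑_t γ^t r(s_t, a_t)]`. -/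
def expectedReturn [StandardBorelSpace A] (M : MDP S A) (μ : Kernel S A) [IsMarkovKernel μ]
    (π : Policy S A) (ρ : Measure ((S × A) × ℤ)) : ℝ :=
  ∫ ω, ∑' t : ℕ, M.γ ^ t * M.reward (ω t).1 ∂(trajLaw M μ π ρ)

/-- The budget constraint: almost every trajectory has `b_t ≥ 0` for all `t ≥ 1`. -/
def Feasible [StandardBorelSpace A] (M : MDP S A) (μ : Kernel S A) [IsMarkovKernel μ]
    (π : Policy S A) (ρ : Measure ((S × A) × ℤ)) : Prop :=
  ∀ᵐ ω ∂(trajLaw M μ π ρ), ∀ t : ℕ, 0 ≤ (ω t).2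

/-- The returns from `s_0 = s`, `a_0 = a`, `b_1 = b` of the policies that keep `b_t ≥ 0` for all
`t ≥ 1`. -/
def qValues [StandardBorelSpace A] (M : MDP S A) (μ : Kernel S A) [IsMarkovKernel μ]
    (s : S) (b : ℕ) (a : A) : Set ℝ :=
  {v | ∃ π : Policy S A, Feasible M μ π (Measure.dirac ((s, a), (b : ℤ))) ∧
    v = expectedReturn M μ π (Measure.dirac ((s, a), (b : ℤ)))}

/-- The returns from `s_0 = s`, `b_0 = b` of the policies that keep `b_t ≥ 0` for all `t`. -/
def vValues [StandardBorelSpace A] (M : MDP S A) (μ : Kernel S A) [IsMarkovKernel μ]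
    (s : S) (b : ℕ) : Set ℝ :=
  {v | ∃ π : Policy S A, Feasible M μ π (startLaw μ π s b) ∧
    v = expectedReturn M μ π (startLaw μ π s b)}

/-- The optimal budget-constrained state-action value `Q⋆(s, b, a)`. -/
def QStar [StandardBorelSpace A] (M : MDP S A) (μ : Kernel S A) [IsMarkovKernel μ]
    (s : S) (b : ℕ) (a : A) : ℝ :=
  sSup (qValues M μ s b a)

/-- The optimal budget-constrained state value `V⋆(s, b)`. -/
def VStar [StandardBorelSpace A] (M : MDP S A) (μ : Kernel S A) [IsMarkovKernel μ]
    (s : S) (b : ℕ) : ℝ :=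
  sSup (vValues M μ s b)

/-- The backup value `V_Q(s, b)`. -/
def backup (μ : Kernel S A) (Q : S → ℕ → A → ℝ) (s : S) : ℕ → ℝ
  | 0 => ∫ a, Q s 0 a ∂(μ s)
  | b + 1 => max (⨆ a, Q s b a) (∫ a, Q s (b + 1) a ∂(μ s))

/-- The counterfactual-budgeting Bellman operator. -/
def bellman (M : MDP S A) (μ : Kernel S A) (Q : S → ℕ → A → ℝ) : S → ℕ → A → ℝ :=
  fun s b a => M.reward (s, a) + M.γ * ∫ s', backup μ Q s' b ∂(M.transition (s, a))

/-- The supremum norm on functions of state, budget and action, as an extended number. -/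
def supNorm (Q : S → ℕ → A → ℝ) : ℝ≥0∞ :=
  ⨆ (s : S) (b : ℕ) (a : A), ‖Q s b a‖ₑ

/-- The operator is meaningful at `Q`: `Q` is bounded and all expectations that occur in
`bellman M μ Q` are expectations of almost everywhere measurable functions. -/
structure InDomain (M : MDP S A) (μ : Kernel S A) (Q : S → ℕ → A → ℝ) : Prop where
  bounded : ∃ C : ℝ, ∀ s b a, |Q s b a| ≤ C
  aesm_action : ∀ s b, AEStronglyMeasurable (Q s b) (μ s)
  aesm_state : ∀ s b a, AEStronglyMeasurable (fun s' => backup μ Q s' b) (M.transition (s, a))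

/-- The space of bounded `Q`-functions on which the operator acts: bounded functions such that each
`Q(·, b, ·)` is upper semianalytic. (Borel measurability is not preserved by `sup_a` when `A` is
uncountable; for countable `S` and `A` with the discrete topology these are all bounded
functions.) -/
structure IsQFunction [TopologicalSpace S] [TopologicalSpace A] (Q : S → ℕ → A → ℝ) : Prop where
  bounded : ∃ C : ℝ, ∀ s b a, |Q s b a| ≤ C
  upperSemianalytic : ∀ (b : ℕ) (c : ℝ), AnalyticSet {x : S × A | c < Q x.1 b x.2}

end CounterfactualBudget

end

open CounterfactualBudget

/-!
The proof is dynamic programming, and its substance is measure theory, since `sup_a` takes Borel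
functions to upper semianalytic ones and near-optimal actions can only be selected universally
measurably.

*Analytic sets.* An analytic set is the image of Baire space under a continuous `f`. For a finite
measure `ν`, continuity from below picks a point `σ` such that the images of the finite boxes below
`σ` keep more than a prescribed mass, and by compactness the closures of these images shrink to the
image of all points below `σ` (`lt_measure_range_iff`). This gives universal measurability of
analytic sets, and for a Borel kernel `κ` it exhibits `{y | c < κ y s}` as the projection of a Borel
set of pairs `(y, σ)`; no topology on the space of measures is needed. Applied to the region under a
graph, it shows that integration against a kernel preserves upper semianalytic functions
(`UpperSemianalytic.integral_kernel`). Hence the Bellman operator acts on the upper semianalytic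
functions, where iteration from `0` converges to a fixed point `Q` that is increasing in the budget
(`exists_bellman_fixedPoint`).

*Upper bound.* Feasibility and expected return depend only on the one-dimensional laws of the
controlled process. Under a feasible policy each step either follows the behaviour policy for free or
spends one unit, so its one-step value is at most the backup of `Q`; telescoping bounds the return by
`Q` (`expectedReturn_le`).

*Lower bound.* Leftmost branches of trees give a universally measurable selection
(`exists_universallyMeasurable_selection`), and so actions within `ε` of `sup_a Q`, or maximizing
ones if the supremum is attained. A policy has to be a Borel kernel, while the law of the process
depends on the policy. The way out is to dominate first, by a single measure, all states that can be
reached with the selectors (`exists_dominating_measure`), then to replace selectors and spending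
regions by Borel versions, and finally to discard a null set with absorbing complement
(`exists_nearOptimalOn`). Spending on an action whose point mass equals the behaviour policy costs
nothing, which is harmless because `Q` is increasing in the budget. Telescoping again bounds the loss
(`NearOptimalOn.le_expectedReturn`). So `Q` and its backup are the least upper bounds that define the
optimal values, and the same argument with `ε = 0` gives an optimal policy.
-/

namespace CounterfactualBudget

open Set Filter Topology

/-! ### Analytic sets and finite measures -/

theorem AnalyticSet.union {X : Type*} [TopologicalSpace X] {s t : Set X}
    (hs : AnalyticSet s) (ht : AnalyticSet t) : AnalyticSet (s ∪ t) := by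
  rw [union_eq_iUnion]
  exact AnalyticSet.iUnion fun b => by cases b <;> simpa

theorem AnalyticSet.inter {X : Type*} [TopologicalSpace X] [T2Space X] {s t : Set X}
    (hs : AnalyticSet s) (ht : AnalyticSet t) : AnalyticSet (s ∩ t) := by
  rw [inter_eq_iInter]
  exact AnalyticSet.iInter fun b => by cases b <;> simpa

/-- The points of Baire space whose first `n` coordinates are bounded by those of `σ`. -/
def box (n : ℕ) (σ : Fin n → ℕ) : Set (ℕ → ℕ) := {x | ∀ i : Fin n, x i ≤ σ i}

/-- For a continuous image of Baire space, the closures of the images of the boxes below `σ` shrink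
to the image of the compact set of all points below `σ`. -/
theorem iInter_closure_image_box_subset {X : Type*} [TopologicalSpace X] [PolishSpace X]
    {f : (ℕ → ℕ) → X} (hf : Continuous f) (σ : ℕ → ℕ) :
    ⋂ n, closure (f '' box n (fun i => σ i)) ⊆ f '' Iic σ := by
  let := TopologicalSpace.upgradeIsCompletelyMetrizable X
  intro y hy
  simp only [mem_iInter] at hy
  have h : ∀ n : ℕ, ∃ x ∈ box n (fun i => σ i), dist y (f x) < 1 / ((n : ℝ) + 1) := by
    intro n
    obtain ⟨z, ⟨x, hx, rfl⟩, hz⟩ :=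
      Metric.mem_closure_iff.1 (hy n) _ (Nat.one_div_pos_of_nat (n := n))
    exact ⟨x, hx, hz⟩
  choose x hx hd using h
  have hcomp : IsCompact (Iic σ) := Icc_bot (a := σ) ▸ isCompact_Icc
  -- Truncation at `σ` moves the sequence into a compact set. Each coordinate of `x n` is changed
  -- for finitely many `n` only, so that convergence of the truncations is convergence of `x`.
  obtain ⟨z, hz, φ, hφ, hlim⟩ := hcomp.tendsto_subseq (x := fun n => x n ⊓ σ)
    (fun n => Set.mem_Iic.2 inf_le_right)
  have hlim' : Tendsto (fun n => x (φ n)) atTop (𝓝 z) := by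
    rw [tendsto_pi_nhds] at hlim ⊢
    intro i
    refine (hlim i).congr' ?_
    filter_upwards [eventually_gt_atTop i] with n hn
    have : i < φ n := hn.trans_le (hφ.id_le n)
    simpa using hx (φ n) ⟨i, this⟩
  refine ⟨z, hz, ?_⟩
  have h1 : Tendsto (fun n => f (x (φ n))) atTop (𝓝 (f z)) := (hf.tendsto z).comp hlim'
  have h2 : Tendsto (fun n => f (x n)) atTop (𝓝 y) := by
    rw [tendsto_iff_dist_tendsto_zero]
    refine squeeze_zero (fun _ => dist_nonneg) (fun n => ?_) tendsto_one_div_add_atTop_nhds_zero_nat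
    rw [dist_comm]
    exact (hd n).le
  exact tendsto_nhds_unique h1 (h2.comp hφ.tendsto_atTop)

/-- The measure of a continuous image of Baire space is nearly carried by the images of the boxes
below a suitable `σ`; its coordinates are found one after the other by continuity from below. -/
theorem exists_lt_measure_image_box {X : Type*} [MeasurableSpace X] (ν : Measure X)
    (f : (ℕ → ℕ) → X) {c : ℝ≥0∞} (hc : c < ν (range f)) :
    ∃ σ : ℕ → ℕ, ∀ n, c < ν (f '' box n (fun i => σ i)) := by
  have step : ∀ (n : ℕ) (τ : Fin n → ℕ), c < ν (f '' box n τ) →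
      ∃ k : ℕ, c < ν (f '' box (n + 1) (Fin.snoc τ k : Fin (n + 1) → ℕ)) := by
    intro n τ h
    have hU : f '' box n τ = ⋃ k : ℕ, f '' box (n + 1) (Fin.snoc τ k : Fin (n + 1) → ℕ) := by
      rw [← image_iUnion]
      congr 1
      ext x
      simp only [box, Set.mem_ofPred_eq, mem_iUnion, Fin.forall_fin_succ', Fin.snoc_castSucc,
        Fin.snoc_last, Fin.val_castSucc, Fin.val_last]
      exact ⟨fun h => ⟨x n, h, le_rfl⟩, fun ⟨k, h, _⟩ => h⟩
    have hmono : Monotone fun k : ℕ => f '' box (n + 1) (Fin.snoc τ k : Fin (n + 1) → ℕ) := by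
      intro k l hkl
      refine image_mono fun x hx => ?_
      simp only [box, Set.mem_ofPred_eq, Fin.forall_fin_succ', Fin.snoc_castSucc,
        Fin.snoc_last, Fin.val_castSucc, Fin.val_last] at hx ⊢
      exact ⟨hx.1, hx.2.trans hkl⟩
    rw [hU, hmono.measure_iUnion] at h
    exact lt_iSup_iff.1 h
  choose! k hk using step
  let τ : (n : ℕ) → Fin n → ℕ := fun n =>
    Nat.rec (fun i => i.elim0) (fun n t => (Fin.snoc t (k n t) : Fin (n + 1) → ℕ)) n
  have hτ : ∀ n, c < ν (f '' box n (τ n)) := by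
    intro n
    induction n with
    | zero =>
      have : box 0 (τ 0) = univ := by ext; simp [box]
      rwa [this, image_univ]
    | succ n ih => exact hk n (τ n) ih
  have hτσ : ∀ n (i : Fin n), τ n i = k i (τ i) := by
    intro n
    induction n with
    | zero => exact fun i => i.elim0
    | succ n ih =>
      intro i
      refine Fin.lastCases ?_ (fun j => ?_) i
      · change (Fin.snoc (τ n) (k n (τ n)) : Fin (n + 1) → ℕ) (Fin.last n) = _
        rw [Fin.snoc_last]; rfl
      · change (Fin.snoc (τ n) (k n (τ n)) : Fin (n + 1) → ℕ) j.castSucc = _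
        rw [Fin.snoc_castSucc]; exact ih j
  refine ⟨fun n => k n (τ n), fun n => ?_⟩
  rw [show (fun i : Fin n => k i (τ i)) = τ n from funext fun i => (hτσ n i).symm]
  exact hτ n

theorem isCompact_image_Iic {X : Type*} [TopologicalSpace X]
    {f : (ℕ → ℕ) → X} (hf : Continuous f) (σ : ℕ → ℕ) : IsCompact (f '' Iic σ) := by
  rw [← Icc_bot]
  exact isCompact_Icc.image hf

theorem le_measure_image_Iic {X : Type*} [TopologicalSpace X] [PolishSpace X]
    [MeasurableSpace X] [BorelSpace X] (ν : Measure X) [IsFiniteMeasure ν]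
    {f : (ℕ → ℕ) → X} (hf : Continuous f) {σ : ℕ → ℕ} {c : ℝ≥0∞}
    (h : ∀ n, c ≤ ν (closure (f '' box n (fun i => σ i)))) : c ≤ ν (f '' Iic σ) := by
  refine le_trans ?_ (measure_mono (iInter_closure_image_box_subset hf σ))
  have hanti : Antitone fun n => closure (f '' box n (fun i => σ i)) := by
    intro m n hmn
    exact closure_mono (image_mono fun x hx i => hx ⟨i, i.2.trans_le hmn⟩)
  rw [hanti.measure_iInter (fun n => isClosed_closure.measurableSet.nullMeasurableSet)
    ⟨0, measure_ne_top _ _⟩]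
  exact le_iInf h

/-- The measure of an analytic set exceeds `c` if and only if the closed sets attached to some `σ`
have measures bounded below by some rational above `c`. The `n`-th condition involves only the first
`n` coordinates of `σ`, which makes it Borel in `σ` and in a parameter of `ν`. -/
theorem lt_measure_range_iff {X : Type*} [TopologicalSpace X] [PolishSpace X]
    [MeasurableSpace X] [BorelSpace X] (ν : Measure X) [IsFiniteMeasure ν]
    {f : (ℕ → ℕ) → X} (hf : Continuous f) {c : ℝ≥0∞} :
    c < ν (range f) ↔ ∃ q : ℚ, c < (Real.toNNReal q : ℝ≥0∞) ∧
      ∃ σ : ℕ → ℕ, ∀ n, (Real.toNNReal q : ℝ≥0∞) ≤ ν (closure (f '' box n (fun i => σ i))) := by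
  constructor
  · intro h
    obtain ⟨q, -, hcq, hq⟩ := ENNReal.lt_iff_exists_rat_btwn.1 h
    obtain ⟨σ, hσ⟩ := exists_lt_measure_image_box ν f hq
    exact ⟨q, hcq, σ, fun n => (hσ n).le.trans (measure_mono subset_closure)⟩
  · rintro ⟨q, hcq, σ, hσ⟩
    exact hcq.trans_le
      ((le_measure_image_Iic ν hf hσ).trans (measure_mono (image_subset_range _ _)))

/-- Analytic sets are universally measurable. -/
theorem AnalyticSet.nullMeasurableSet {X : Type*} [TopologicalSpace X] [PolishSpace X]
    [MeasurableSpace X] [BorelSpace X] {s : Set X} (hs : AnalyticSet s) (ν : Measure X)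
    [IsFiniteMeasure ν] : NullMeasurableSet s ν := by
  rw [AnalyticSet] at hs
  obtain rfl | ⟨f, hf, rfl⟩ := hs
  · exact nullMeasurableSet_empty
  by_cases h0 : ν (range f) = 0
  · exact NullMeasurableSet.of_null h0
  obtain ⟨u, -, hu, hlim⟩ := exists_seq_strictMono_tendsto' (pos_iff_ne_zero.2 h0)
  have h : ∀ n, ∃ σ : ℕ → ℕ, u n ≤ ν (f '' Iic σ) := by
    intro n
    obtain ⟨σ, hσ⟩ := exists_lt_measure_image_box ν f (hu n).2
    exact ⟨σ, le_measure_image_Iic ν hf fun m => (hσ m).le.trans (measure_mono subset_closure)⟩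
  choose σ hσ using h
  have hm : MeasurableSet (⋃ n, f '' Iic (σ n)) :=
    MeasurableSet.iUnion fun n => (isCompact_image_Iic hf _).measurableSet
  have hsub : (⋃ n, f '' Iic (σ n)) ⊆ range f := iUnion_subset fun n => image_subset_range _ _
  refine hm.nullMeasurableSet.congr (ae_eq_of_subset_of_measure_ge hsub ?_ hm.nullMeasurableSet
    (measure_ne_top _ _))
  exact le_of_tendsto' hlim fun n => (hσ n).trans (measure_mono (subset_iUnion_of_subset n le_rfl))

/-- If `s` is analytic and `κ` is a Borel kernel then `{y | c < κ y s}` is analytic: it is the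
projection of the Borel set of pairs `(y, σ)` for which `κ y` gives enough mass to the part of `s`
that lies below `σ`. -/
theorem AnalyticSet.setOf_lt_kernel {X Y : Type*} [TopologicalSpace X] [PolishSpace X]
    [MeasurableSpace X] [BorelSpace X] [TopologicalSpace Y] [PolishSpace Y]
    [MeasurableSpace Y] [BorelSpace Y] (κ : Kernel Y X) [IsFiniteKernel κ]
    {s : Set X} (hs : AnalyticSet s) (c : ℝ≥0∞) : AnalyticSet {y | c < κ y s} := by
  rw [AnalyticSet] at hs
  obtain rfl | ⟨f, hf, rfl⟩ := hs
  · simpa using analyticSet_empty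
  have heq : {y | c < κ y (range f)} = ⋃ q : {q : ℚ // c < (Real.toNNReal q : ℝ≥0∞)},
      Prod.fst '' ⋂ n, {p : Y × (ℕ → ℕ) | (Real.toNNReal (q : ℚ) : ℝ≥0∞) ≤
        κ p.1 (closure (f '' box n (fun i => p.2 i)))} := by
    ext y
    simp [lt_measure_range_iff (κ y) hf]
  rw [heq]
  refine AnalyticSet.iUnion fun q => MeasurableSet.analyticSet_image
    (MeasurableSet.iInter fun n => ?_) measurable_fst
  refine measurableSet_le measurable_const ?_
  have h1 : Measurable fun p : Y × (Fin n → ℕ) => κ p.1 (closure (f '' box n p.2)) :=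
    measurable_from_prod_countable_left fun τ =>
      κ.measurable_coe (isClosed_closure (s := f '' box n τ)).measurableSet
  have h2 : Measurable fun p : Y × (ℕ → ℕ) => (p.1, fun i : Fin n => p.2 i) := by fun_prop
  exact h1.comp h2

/-! ### Upper semianalytic functions -/

/-- A real function is upper semianalytic if its strict upper level sets are analytic. -/
def UpperSemianalytic {X : Type*} [TopologicalSpace X] (g : X → ℝ) : Prop :=
  ∀ c : ℝ, AnalyticSet {x | c < g x}

/-- A function is universally measurable if it is almost everywhere measurable for every finite
measure. -/
def UniversallyMeasurable {X Z : Type*} [MeasurableSpace X] [MeasurableSpace Z] (f : X → Z) :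
    Prop :=
  ∀ ν : Measure X, IsFiniteMeasure ν → AEMeasurable f ν

theorem UniversallyMeasurable.aemeasurable {X Z : Type*} [MeasurableSpace X] [MeasurableSpace Z]
    {f : X → Z} (hf : UniversallyMeasurable f) (ν : Measure X) [SFinite ν] : AEMeasurable f ν := by
  rw [← sum_sfiniteSeq ν]
  exact aemeasurable_sum_measure_iff.2 fun n => hf _ inferInstance

theorem UniversallyMeasurable.aestronglyMeasurable {X : Type*} [MeasurableSpace X]
    {f : X → ℝ} (hf : UniversallyMeasurable f) (ν : Measure X) [SFinite ν] :
    AEStronglyMeasurable f ν :=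
  (hf.aemeasurable ν).aestronglyMeasurable

theorem UniversallyMeasurable.integrable {X : Type*} [MeasurableSpace X]
    {f : X → ℝ} (hf : UniversallyMeasurable f) {C : ℝ} (hC : ∀ x, |f x| ≤ C)
    (ν : Measure X) [IsFiniteMeasure ν] : Integrable f ν :=
  Integrable.of_bound (hf.aestronglyMeasurable ν) C (Eventually.of_forall hC)

theorem UniversallyMeasurable.comp {X Y Z : Type*} [MeasurableSpace X] [MeasurableSpace Y]
    [MeasurableSpace Z] {g : Y → Z} {f : X → Y} (hg : UniversallyMeasurable g)
    (hf : UniversallyMeasurable f) : UniversallyMeasurable (g ∘ f) := fun ν _ =>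
  (hg _ inferInstance).comp_aemeasurable (hf ν inferInstance)

theorem _root_.Measurable.universallyMeasurable {X Z : Type*} [MeasurableSpace X]
    [MeasurableSpace Z] {f : X → Z} (hf : Measurable f) : UniversallyMeasurable f :=
  fun _ _ => hf.aemeasurable

theorem UniversallyMeasurable.prodMk {X Y Z : Type*} [MeasurableSpace X] [MeasurableSpace Y]
    [MeasurableSpace Z] {g : X → Z} {f : X → Y} (hf : UniversallyMeasurable f)
    (hg : UniversallyMeasurable g) : UniversallyMeasurable fun x => (f x, g x) := fun ν h =>
  (hf ν h).prodMk (hg ν h)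

namespace UpperSemianalytic

variable {X Y : Type*} [TopologicalSpace X] [TopologicalSpace Y]

theorem universallyMeasurable [PolishSpace X] [MeasurableSpace X] [BorelSpace X] {g : X → ℝ}
    (hg : UpperSemianalytic g) : UniversallyMeasurable g := by
  intro ν _
  refine NullMeasurable.aemeasurable ?_
  exact measurable_of_Ioi (α := ℝ) (δ := NullMeasurableSpace X ν)
    fun c => AnalyticSet.nullMeasurableSet (hg c) ν

theorem analyticSet_of_forall_mem_iff {g : X → ℝ} {s : Set X} (hs : AnalyticSet s) {c : ℝ}
    (h : ∀ x, x ∈ s ↔ c < g x) : AnalyticSet {x | c < g x} := by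
  rwa [show {x | c < g x} = s from Set.ext fun x => (h x).symm]

theorem _root_.Measurable.upperSemianalytic [PolishSpace X] [MeasurableSpace X] [BorelSpace X]
    {g : X → ℝ} (hg : Measurable g) : UpperSemianalytic g := fun _ =>
  (measurableSet_lt measurable_const hg).analyticSet

theorem const [PolishSpace X] (k : ℝ) : UpperSemianalytic fun _ : X => k := by
  borelize X
  exact measurable_const.upperSemianalytic

theorem comp_continuous [PolishSpace X] [T2Space Y] {g : Y → ℝ} (hg : UpperSemianalytic g)
    {f : X → Y} (hf : Continuous f) : UpperSemianalytic (g ∘ f) := fun c => (hg c).preimage hf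

theorem add [T2Space X] {g h : X → ℝ} (hg : UpperSemianalytic g) (hh : UpperSemianalytic h) :
    UpperSemianalytic fun x => g x + h x := by
  intro c
  have : {x | c < g x + h x} = ⋃ q : ℚ, {x | (q : ℝ) < g x} ∩ {x | c - q < h x} := by
    ext x
    simp only [Set.mem_ofPred_eq, mem_iUnion, mem_inter_iff]
    constructor
    · intro hx
      obtain ⟨q, hq1, hq2⟩ := exists_rat_btwn (show c - h x < g x by linarith)
      exact ⟨q, hq2, by linarith⟩
    · rintro ⟨q, h1, h2⟩
      linarith
  rw [this]
  exact AnalyticSet.iUnion fun q => AnalyticSet.inter (hg _) (hh _)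

theorem const_mul [PolishSpace X] {g : X → ℝ} (hg : UpperSemianalytic g) {k : ℝ}
    (hk : 0 ≤ k) : UpperSemianalytic fun x => k * g x := by
  rcases hk.eq_or_lt with rfl | hk
  · simpa using const (X := X) 0
  · intro c
    have : {x | c < k * g x} = {x | c / k < g x} := by
      ext x
      simp [div_lt_iff₀' hk]
    rw [this]
    exact hg _

theorem max {g h : X → ℝ} (hg : UpperSemianalytic g) (hh : UpperSemianalytic h) :
    UpperSemianalytic fun x => max (g x) (h x) := by
  intro c
  simp only [lt_max_iff, Set.ofPred_or]
  exact AnalyticSet.union (hg c) (hh c)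

theorem ciSup [PolishSpace X] {g : X × Y → ℝ}
    (hg : UpperSemianalytic g) (hb : ∀ x, BddAbove (range fun y => g (x, y))) :
    UpperSemianalytic fun x => ⨆ y, g (x, y) := by
  rcases isEmpty_or_nonempty Y with hY | hY
  · simpa using const (X := X) 0
  intro c
  have : {x | c < ⨆ y, g (x, y)} = Prod.fst '' {p | c < g p} := by
    ext x
    simp [lt_ciSup_iff (hb x)]
  rw [this]
  exact (hg c).image_of_continuous continuous_fst

/-- Uniform limits of upper semianalytic functions are upper semianalytic. -/
theorem of_uniform_limit {g : ℕ → X → ℝ} {h : X → ℝ} (hg : ∀ n, UpperSemianalytic (g n))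
    {ε : ℕ → ℝ} (hε : Tendsto ε atTop (𝓝 0)) (hle : ∀ n x, |g n x - h x| ≤ ε n) :
    UpperSemianalytic h := by
  intro c
  have : {x | c < h x} = ⋃ n, {x | c + ε n < g n x} := by
    ext x
    simp only [Set.mem_ofPred_eq, mem_iUnion]
    constructor
    · intro hx
      have : ∀ᶠ n in atTop, ε n < (h x - c) / 2 := hε.eventually_lt_const (by linarith)
      obtain ⟨n, hn⟩ := this.exists
      have := abs_le.1 (hle n x)
      exact ⟨n, by linarith [this.1]⟩
    · rintro ⟨n, hn⟩
      have := abs_le.1 (hle n x)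
      linarith [this.2]
  rw [this]
  exact AnalyticSet.iUnion fun n => hg n _

/-- Integration against a Borel kernel preserves upper semianalyticity. -/
theorem integral_kernel [PolishSpace X] [PolishSpace Y] [MeasurableSpace X] [BorelSpace X]
    [MeasurableSpace Y] [BorelSpace Y]
    (κ : Kernel Y X) [IsMarkovKernel κ] {g : X → ℝ} (hg : UpperSemianalytic g) {C : ℝ}
    (hC : ∀ x, |g x| ≤ C) : UpperSemianalytic fun y => ∫ x, g x ∂(κ y) := by
  intro c
  -- The integral of `g + C` is the measure of the analytic region under its graph.
  set h : X → ℝ := fun x => g x + C with hh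
  have hm : UniversallyMeasurable g := hg.universallyMeasurable
  have h0 : ∀ x, 0 ≤ h x := fun x => by linarith [(abs_le.1 (hC x)).1]
  have h2 : ∀ x, h x ≤ 2 * C := fun x => by linarith [(abs_le.1 (hC x)).2]
  have hh' : UpperSemianalytic h := hg.add (const C)
  have hhm : UniversallyMeasurable h := hh'.universallyMeasurable
  set I : Set ℝ := Ioo 0 (2 * C)
  let η : Kernel Y (X × ℝ) := κ ×ₖ Kernel.const Y (volume.restrict I)
  have hreg : AnalyticSet (regionBetween (fun _ => (0 : ℝ)) h univ) := by
    have : regionBetween (fun _ => (0 : ℝ)) h univ =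
        ⋃ q : ℚ, (Prod.fst ⁻¹' {x | (q : ℝ) < h x}) ∩ (Prod.snd ⁻¹' Ioc (0 : ℝ) q) := by
      ext ⟨x, t⟩
      simp only [regionBetween, mem_univ, true_and, mem_Ioo, Set.mem_ofPred_eq, mem_iUnion,
        mem_inter_iff, mem_preimage, mem_Ioc]
      constructor
      · rintro ⟨ht, hx⟩
        obtain ⟨q, hq1, hq2⟩ := exists_rat_btwn hx
        exact ⟨q, hq2, ht, hq1.le⟩
      · rintro ⟨q, h1, h2, h3⟩
        exact ⟨h2, h3.trans_lt h1⟩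
    rw [this]
    refine AnalyticSet.iUnion fun q => AnalyticSet.inter ((hh' _).preimage continuous_fst) ?_
    exact (measurable_snd measurableSet_Ioc).analyticSet
  have hval : ∀ y, η y (regionBetween (fun _ => (0 : ℝ)) h univ) =
      ENNReal.ofReal (∫ x, h x ∂(κ y)) := by
    intro y
    have hsub : regionBetween (fun _ => (0 : ℝ)) h univ ⊆ univ ×ˢ I := by
      rintro ⟨x, t⟩ ⟨-, ht⟩
      exact ⟨mem_univ _, ht.1, ht.2.trans_le (h2 x)⟩
    have : η y = ((κ y).prod volume).restrict (univ ×ˢ I) := by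
      rw [← Measure.prod_restrict, Measure.restrict_univ]
      simp [η, Kernel.prod_apply]
    rw [this, Measure.restrict_eq_self _ hsub, volume_regionBetween_eq_lintegral
      aemeasurable_const (hhm.aemeasurable _) MeasurableSet.univ, Measure.restrict_univ,
      ofReal_integral_eq_lintegral_ofReal (hhm.integrable (C := 2 * C) (fun x => by
        rw [abs_of_nonneg (h0 x)]; exact h2 x) _) (Eventually.of_forall h0)]
    simp
  have hint : ∀ y, ∫ x, h x ∂(κ y) = ∫ x, g x ∂(κ y) + C := by
    intro y
    rw [hh, integral_add (hm.integrable hC _) (integrable_const _)]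
    simp
  by_cases hc : 0 ≤ c + C
  · refine analyticSet_of_forall_mem_iff
      (AnalyticSet.setOf_lt_kernel η hreg (ENNReal.ofReal (c + C))) fun y => ?_
    rw [Set.mem_ofPred_eq, hval, hint, ENNReal.ofReal_lt_ofReal_iff_of_nonneg hc]
    simp
  · refine analyticSet_of_forall_mem_iff MeasurableSet.univ.analyticSet fun y => ?_
    have : 0 ≤ ∫ x, h x ∂(κ y) := integral_nonneg h0
    rw [hint] at this
    simp only [mem_univ, true_iff]
    linarith

end UpperSemianalytic

/-! ### Universally measurable selection -/

section Selection

variable {X Y : Type*}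

/-- The values of `g` at the points of Baire space whose initial segment is `u`, listed from the
last entry to the first, as in `PiNat.res`. -/
def branch (g : (ℕ → ℕ) → X) (u : List ℕ) : Set X :=
  g '' {z | PiNat.res z u.length = u}

/-- The initial segment of length `n` of the leftmost point of the fibre of `g` over `x`, from the
last entry to the first. -/
noncomputable def leftmostSegment (g : (ℕ → ℕ) → X) (x : X) : ℕ → List ℕ
  | 0 => []
  | n + 1 => sInf {k | x ∈ branch g (k :: leftmostSegment g x n)} :: leftmostSegment g x n

/-- The leftmost point of the fibre of `g` over `x`. -/
noncomputable def leftmost (g : (ℕ → ℕ) → X) (x : X) (n : ℕ) : ℕ :=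
  sInf {k | x ∈ branch g (k :: leftmostSegment g x n)}

theorem res_leftmost (g : (ℕ → ℕ) → X) (x : X) (n : ℕ) :
    PiNat.res (leftmost g x) n = leftmostSegment g x n := by
  induction n with
  | zero => rfl
  | succ n ih => rw [PiNat.res_succ, ih]; rfl

theorem mem_branch_leftmostSegment {g : (ℕ → ℕ) → X} {x : X} (hx : x ∈ range g) (n : ℕ) :
    x ∈ branch g (leftmostSegment g x n) := by
  induction n with
  | zero =>
    obtain ⟨z, rfl⟩ := hx
    exact ⟨z, rfl, rfl⟩
  | succ n ih =>
    have : {k | x ∈ branch g (k :: leftmostSegment g x n)}.Nonempty := by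
      obtain ⟨z, hz, rfl⟩ := ih
      refine ⟨z (leftmostSegment g (g z) n).length, z, ?_, rfl⟩
      simp only [Set.mem_ofPred_eq] at hz
      simp only [Set.mem_ofPred_eq, List.length_cons, PiNat.res_succ, hz]
    exact Nat.sInf_mem this

theorem apply_leftmost [TopologicalSpace X] [T2Space X] {g : (ℕ → ℕ) → X} (hg : Continuous g)
    {x : X} (hx : x ∈ range g) : g (leftmost g x) = x := by
  have h : ∀ n, ∃ z, PiNat.res z n = PiNat.res (leftmost g x) n ∧ g z = x := by
    intro n
    obtain ⟨z, hz, hzx⟩ := mem_branch_leftmostSegment hx n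
    rw [← res_leftmost, PiNat.res_length] at hz
    exact ⟨z, hz, hzx⟩
  choose z hz hzx using h
  have hlim : Tendsto z atTop (𝓝 (leftmost g x)) := by
    rw [tendsto_pi_nhds]
    intro i
    refine tendsto_const_nhds.congr' ?_
    filter_upwards [eventually_gt_atTop i] with n hn
    exact (PiNat.res_eq_res.1 (hz n) hn).symm
  refine tendsto_nhds_unique ((hg.tendsto _).comp hlim) ?_
  simp [Function.comp_def, hzx]

theorem isOpen_setOf_res_eq (n : ℕ) (u : List ℕ) : IsOpen {z : ℕ → ℕ | PiNat.res z n = u} := by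
  rw [isOpen_iff_mem_nhds]
  rintro z rfl
  filter_upwards [(PiNat.isOpen_cylinder (fun _ : ℕ => ℕ) z n).mem_nhds
    (PiNat.self_mem_cylinder z n)] with y hy
  rwa [PiNat.cylinder_eq_res] at hy

theorem analyticSet_branch [TopologicalSpace X] {g : (ℕ → ℕ) → X} (hg : Continuous g)
    (u : List ℕ) : AnalyticSet (branch g u) :=
  (isOpen_setOf_res_eq _ u).analyticSet_image hg

theorem measurable_sInf_setOf [MeasurableSpace X] {p : ℕ → X → Prop}
    (hp : ∀ k, MeasurableSet {x | p k x}) : Measurable fun x => sInf {k | p k x} := by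
  refine measurable_to_countable' fun k => ?_
  have : (fun x => sInf {k | p k x}) ⁻¹' {k} = ({x | p k x} ∩ ⋂ j : ℕ, ⋂ _ : j < k, {x | p j x}ᶜ) ∪
      ({_x : X | k = 0} ∩ ⋂ j, {x | p j x}ᶜ) := by
    ext x
    simp only [mem_preimage, mem_singleton_iff, mem_union, mem_inter_iff, mem_iInter,
      mem_compl_iff, Set.mem_ofPred_eq]
    constructor
    · rintro rfl
      rcases Set.eq_empty_or_nonempty {k | p k x} with h | h
      · right
        refine ⟨by rw [h, Nat.sInf_empty], fun j hj => ?_⟩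
        exact (h ▸ hj : j ∈ (∅ : Set ℕ))
      · exact Or.inl ⟨Nat.sInf_mem h, fun j hj => Nat.notMem_of_lt_sInf hj⟩
    · rintro (⟨h1, h2⟩ | ⟨rfl, h⟩)
      · refine le_antisymm (Nat.sInf_le h1) ?_
        by_contra! hlt
        exact h2 _ hlt (Nat.sInf_mem (s := {k | p k x}) ⟨k, h1⟩)
      · rw [show {k | p k x} = ∅ from Set.eq_empty_of_forall_notMem h, Nat.sInf_empty]
  rw [this]
  exact ((hp k).inter (.iInter fun j => .iInter fun _ => (hp j).compl)).union
    (.inter (.const _) (.iInter fun j => (hp j).compl))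

/-- The leftmost point of a fibre depends measurably on the base point, for every `σ`-algebra that
contains the analytic sets. -/
theorem measurable_leftmost [TopologicalSpace X] {m : MeasurableSpace X}
    (hm : ∀ s : Set X, AnalyticSet s → MeasurableSet s) {g : (ℕ → ℕ) → X} (hg : Continuous g) :
    Measurable (leftmost g) := by
  let _ : MeasurableSpace (List ℕ) := ⊤
  have hF : ∀ (u : List ℕ), Measurable fun x => sInf {k | x ∈ branch g (k :: u)} := fun u =>
    measurable_sInf_setOf (p := fun k x => x ∈ branch g (k :: u)) fun k =>
      hm _ (analyticSet_branch hg (k :: u))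
  have hF' : Measurable fun p : X × List ℕ => sInf {k | p.1 ∈ branch g (k :: p.2)} :=
    measurable_from_prod_countable_left hF
  have hseg : ∀ n, Measurable fun x => leftmostSegment g x n := by
    intro n
    induction n with
    | zero => exact measurable_const
    | succ n ih =>
      have hc : Measurable fun p : ℕ × List ℕ => p.1 :: p.2 := Measurable.of_discrete
      simp only [leftmostSegment]
      have h1 := hF'.comp (g := fun p : X × List ℕ => sInf {k | p.1 ∈ branch g (k :: p.2)})
        (f := fun x => (x, leftmostSegment g x n)) (measurable_id.prodMk ih)
      exact hc.comp (h1.prodMk ih)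
  refine measurable_pi_iff.2 fun n => ?_
  simp only [leftmost]
  have h := measurable_id.prodMk (hseg n)
  exact hF'.comp (g := fun p : X × List ℕ => sInf {k | p.1 ∈ branch g (k :: p.2)})
    (f := fun x => (x, leftmostSegment g x n)) h

/-- **Jankov–von Neumann selection.** An analytic subset of a product has a universally measurable
uniformization. -/
theorem exists_universallyMeasurable_selection [TopologicalSpace X] [PolishSpace X]
    [MeasurableSpace X] [BorelSpace X] [TopologicalSpace Y] [PolishSpace Y] [MeasurableSpace Y]
    [BorelSpace Y] [Nonempty Y] {E : Set (X × Y)} (hE : AnalyticSet E) :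
    ∃ φ : X → Y, UniversallyMeasurable φ ∧ ∀ x, (∃ y, (x, y) ∈ E) → (x, φ x) ∈ E := by
  rw [AnalyticSet] at hE
  obtain rfl | ⟨f, hf, rfl⟩ := hE
  · exact ⟨fun _ => Classical.arbitrary Y, measurable_const.universallyMeasurable, by simp⟩
  have hg : Continuous fun z => (f z).1 := continuous_fst.comp hf
  refine ⟨fun x => (f (leftmost (fun z => (f z).1) x)).2, fun ν _ => ?_, ?_⟩
  · have h1 : Measurable fun z => (f z).2 := (continuous_snd.comp hf).measurable
    have h2 : @Measurable (NullMeasurableSpace X ν) _ _ _ (leftmost fun z => (f z).1) :=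
      measurable_leftmost (X := X)
        (m := (inferInstance : MeasurableSpace (NullMeasurableSpace X ν)))
        (fun s hs => AnalyticSet.nullMeasurableSet hs ν) hg
    exact NullMeasurable.aemeasurable (h1.comp h2)
  · rintro x ⟨y, z, hz⟩
    have h := apply_leftmost hg (x := x) ⟨z, by simp [hz]⟩
    exact ⟨leftmost (fun z => (f z).1) x, Prod.ext h rfl⟩

/-- If `g (s, ·)` reaches the level `v s` for every `s`, then a universally measurable selector
reaches it. The set to be uniformized is `{((s, r), a) | r ≤ g (s, a)}` rather than
`{(s, a) | v s ≤ g (s, a)}`, since the latter need not be analytic. -/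
theorem exists_universallyMeasurable_selector [TopologicalSpace X] [PolishSpace X]
    [MeasurableSpace X] [BorelSpace X] [TopologicalSpace Y] [PolishSpace Y] [MeasurableSpace Y]
    [BorelSpace Y] [Nonempty Y] {g : X × Y → ℝ} (hg : UpperSemianalytic g) {v : X → ℝ}
    (hv : UniversallyMeasurable v) (h : ∀ x, ∃ y, v x ≤ g (x, y)) :
    ∃ φ : X → Y, UniversallyMeasurable φ ∧ ∀ x, v x ≤ g (x, φ x) := by
  have hE : AnalyticSet {p : (X × ℝ) × Y | p.1.2 ≤ g (p.1.1, p.2)} := by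
    have : {p : (X × ℝ) × Y | p.1.2 ≤ g (p.1.1, p.2)} =
        ⋂ n : ℕ, {p | -(1 / ((n : ℝ) + 1)) < g (p.1.1, p.2) + -p.1.2} := by
      ext p
      simp only [Set.mem_ofPred_eq, mem_iInter]
      constructor
      · intro hp n
        have := Nat.one_div_pos_of_nat (α := ℝ) (n := n)
        linarith
      · intro hp
        refine le_of_forall_pos_le_add fun ε hε => ?_
        obtain ⟨n, hn⟩ := exists_nat_one_div_lt hε
        linarith [hp n]
    rw [this]
    refine AnalyticSet.iInter fun n => ?_
    refine UpperSemianalytic.add (g := fun p : (X × ℝ) × Y => g (p.1.1, p.2))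
      (h := fun p => -p.1.2) ?_ ?_ _
    · exact hg.comp_continuous (f := fun p : (X × ℝ) × Y => (p.1.1, p.2)) (by fun_prop)
    · exact Measurable.upperSemianalytic (by fun_prop)
  obtain ⟨φ, hφ, hφE⟩ := exists_universallyMeasurable_selection hE
  refine ⟨φ ∘ fun x => (x, v x), hφ.comp (measurable_id.universallyMeasurable.prodMk hv),
    fun x => hφE (x, v x) (h x)⟩

end Selection

/-! ### The Bellman operator -/

section Bellman

theorem IsQFunction.bddAbove {S A : Type*} [TopologicalSpace S] [TopologicalSpace A]
    {Q : S → ℕ → A → ℝ}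
    (hQ : IsQFunction Q) (s : S) (b : ℕ) :
    BddAbove (range (Q s b)) := by
  obtain ⟨C, hC⟩ := hQ.bounded
  exact ⟨C, by rintro _ ⟨a, rfl⟩; exact (abs_le.1 (hC s b a)).2⟩

variable {S A : Type*} [MeasurableSpace S] [MeasurableSpace A]

theorem abs_integral_le_of_abs_le {X : Type*} [MeasurableSpace X] (ν : Measure X)
    [IsProbabilityMeasure ν] {f : X → ℝ} {C : ℝ} (hf : ∀ x, |f x| ≤ C) : |∫ x, f x ∂ν| ≤ C := by
  have hf' : ∀ x, ‖f x‖ ≤ C := hf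
  simpa using norm_integral_le_of_norm_le_const (μ := ν) (Eventually.of_forall hf')

theorem abs_backup_le (μ : Kernel S A) [IsMarkovKernel μ] {Q : S → ℕ → A → ℝ} {C : ℝ}
    (hC : ∀ s b a, |Q s b a| ≤ C) (s : S) (b : ℕ) : |backup μ Q s b| ≤ C := by
  have hint : ∀ b, |∫ a, Q s b a ∂(μ s)| ≤ C := fun b => abs_integral_le_of_abs_le _ (hC s b)
  have : Nonempty A := (μ s).nonempty_of_neZero
  cases b with
  | zero => exact hint 0
  | succ b =>
    have hsup : |⨆ a, Q s b a| ≤ C := by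
      have hb : BddAbove (range fun a => Q s b a) :=
        ⟨C, by rintro _ ⟨a, rfl⟩; exact (abs_le.1 (hC s b a)).2⟩
      refine abs_le.2 ⟨?_, ciSup_le fun a => (abs_le.1 (hC s b a)).2⟩
      exact le_ciSup_of_le hb (Classical.arbitrary A) (abs_le.1 (hC s b _)).1
    exact abs_max_le_max_abs_abs.trans (max_le hsup (hint _))

theorem abs_ciSup_sub_ciSup_le {ι : Type*} [Nonempty ι] {f g : ι → ℝ} {C D : ℝ}
    (hf : ∀ i, |f i| ≤ C) (hg : ∀ i, |g i| ≤ C) (h : ∀ i, |f i - g i| ≤ D) :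
    |(⨆ i, f i) - ⨆ i, g i| ≤ D := by
  have bf : BddAbove (range f) := ⟨C, by rintro _ ⟨a, rfl⟩; exact (abs_le.1 (hf a)).2⟩
  have bg : BddAbove (range g) := ⟨C, by rintro _ ⟨a, rfl⟩; exact (abs_le.1 (hg a)).2⟩
  rw [abs_sub_le_iff]
  constructor
  · rw [sub_le_iff_le_add]
    exact ciSup_le fun i => by linarith [(abs_le.1 (h i)).2, le_ciSup bg i]
  · rw [sub_le_iff_le_add]
    exact ciSup_le fun i => by linarith [(abs_le.1 (h i)).1, le_ciSup bf i]

theorem abs_integral_sub_integral_le {X : Type*} [MeasurableSpace X] (ν : Measure X)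
    [IsProbabilityMeasure ν] {f g : X → ℝ} {C D : ℝ} (hfm : AEStronglyMeasurable f ν)
    (hgm : AEStronglyMeasurable g ν) (hf : ∀ i, |f i| ≤ C) (hg : ∀ i, |g i| ≤ C)
    (h : ∀ i, |f i - g i| ≤ D) : |∫ x, f x ∂ν - ∫ x, g x ∂ν| ≤ D := by
  rw [← integral_sub (Integrable.of_bound hfm C (Eventually.of_forall hf))
    (Integrable.of_bound hgm C (Eventually.of_forall hg))]
  exact abs_integral_le_of_abs_le ν h

theorem InDomain.exists_bound {M : MDP S A} {μ : Kernel S A} {Q₁ Q₂ : S → ℕ → A → ℝ}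
    (h₁ : InDomain M μ Q₁) (h₂ : InDomain M μ Q₂) :
    ∃ C : ℝ, 0 ≤ C ∧ (∀ s b a, |Q₁ s b a| ≤ C) ∧ ∀ s b a, |Q₂ s b a| ≤ C := by
  obtain ⟨C₁, hC₁⟩ := h₁.bounded
  obtain ⟨C₂, hC₂⟩ := h₂.bounded
  refine ⟨max 0 (max C₁ C₂), le_max_left _ _, fun s b a => (hC₁ s b a).trans (by simp),
    fun s b a => (hC₂ s b a).trans (by simp)⟩

theorem abs_backup_sub_backup_le {M : MDP S A} (μ : Kernel S A) [IsMarkovKernel μ]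
    {Q₁ Q₂ : S → ℕ → A → ℝ} (h₁ : InDomain M μ Q₁) (h₂ : InDomain M μ Q₂) {D : ℝ}
    (hD : ∀ s b a, |Q₁ s b a - Q₂ s b a| ≤ D) (s : S) (b : ℕ) :
    |backup μ Q₁ s b - backup μ Q₂ s b| ≤ D := by
  obtain ⟨C, -, hC₁, hC₂⟩ := h₁.exists_bound h₂
  have hint : ∀ b, |∫ a, Q₁ s b a ∂(μ s) - ∫ a, Q₂ s b a ∂(μ s)| ≤ D := fun b =>
    abs_integral_sub_integral_le _ (h₁.aesm_action s b) (h₂.aesm_action s b) (hC₁ s b) (hC₂ s b)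
      (hD s b)
  have : Nonempty A := (μ s).nonempty_of_neZero
  cases b with
  | zero => exact hint 0
  | succ b =>
    exact (abs_max_sub_max_le_max _ _ _ _).trans
      (max_le (abs_ciSup_sub_ciSup_le (hC₁ s b) (hC₂ s b) (hD s b)) (hint _))

theorem abs_bellman_sub_bellman_le {M : MDP S A} (μ : Kernel S A) [IsMarkovKernel μ]
    {Q₁ Q₂ : S → ℕ → A → ℝ} (h₁ : InDomain M μ Q₁) (h₂ : InDomain M μ Q₂) {D : ℝ}
    (hD : ∀ s b a, |Q₁ s b a - Q₂ s b a| ≤ D) (s : S) (b : ℕ) (a : A) :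
    |bellman M μ Q₁ s b a - bellman M μ Q₂ s b a| ≤ M.γ * D := by
  obtain ⟨C, -, hC₁, hC₂⟩ := h₁.exists_bound h₂
  have := abs_integral_sub_integral_le _ (h₁.aesm_state s b a) (h₂.aesm_state s b a)
    (fun s => abs_backup_le μ hC₁ s b) (fun s => abs_backup_le μ hC₂ s b)
    (fun s => abs_backup_sub_backup_le μ h₁ h₂ hD s b)
  simp only [bellman, add_sub_add_left_eq_sub, ← mul_sub, abs_mul, abs_of_nonneg M.γ_nonneg]
  exact mul_le_mul_of_nonneg_left this M.γ_nonneg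

theorem supNorm_bellman_sub_le {M : MDP S A} (μ : Kernel S A) [IsMarkovKernel μ]
    {Q₁ Q₂ : S → ℕ → A → ℝ} (h₁ : InDomain M μ Q₁) (h₂ : InDomain M μ Q₂) :
    supNorm (bellman M μ Q₁ - bellman M μ Q₂) ≤ ENNReal.ofReal M.γ * supNorm (Q₁ - Q₂) := by
  obtain ⟨C, hC0, hC₁, hC₂⟩ := h₁.exists_bound h₂
  have hle : ∀ s b a, ‖Q₁ s b a - Q₂ s b a‖ₑ ≤ supNorm (Q₁ - Q₂) := fun s b a =>
    le_iSup_of_le s (le_iSup_of_le b (le_iSup_of_le a le_rfl))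
  have hfin : supNorm (Q₁ - Q₂) ≠ ∞ := by
    refine ne_top_of_le_ne_top (b := ENNReal.ofReal (2 * C)) ENNReal.ofReal_ne_top ?_
    refine iSup_le fun s => iSup_le fun b => iSup_le fun a => ?_
    rw [Pi.sub_apply, Pi.sub_apply, Pi.sub_apply, ← ofReal_norm]
    refine ENNReal.ofReal_le_ofReal ((norm_sub_le _ _).trans ?_)
    simp only [Real.norm_eq_abs]
    linarith [hC₁ s b a, hC₂ s b a]
  have hD : ∀ s b a, |Q₁ s b a - Q₂ s b a| ≤ (supNorm (Q₁ - Q₂)).toReal := by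
    intro s b a
    have := ENNReal.toReal_mono hfin (hle s b a)
    simpa using this
  refine iSup_le fun s => iSup_le fun b => iSup_le fun a => ?_
  rw [← ENNReal.ofReal_toReal hfin, ← ENNReal.ofReal_mul M.γ_nonneg, ← ofReal_norm]
  exact ENNReal.ofReal_le_ofReal (abs_bellman_sub_bellman_le μ h₁ h₂ hD s b a)

theorem eq_of_bellman_eq {M : MDP S A} (μ : Kernel S A) [IsMarkovKernel μ]
    {Q₁ Q₂ : S → ℕ → A → ℝ} (h₁ : InDomain M μ Q₁) (h₂ : InDomain M μ Q₂)
    (hQ₁ : bellman M μ Q₁ = Q₁) (hQ₂ : bellman M μ Q₂ = Q₂) : Q₁ = Q₂ := by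
  obtain ⟨C, hC0, hC₁, hC₂⟩ := h₁.exists_bound h₂
  have h : ∀ n : ℕ, ∀ s b a, |Q₁ s b a - Q₂ s b a| ≤ M.γ ^ n * (2 * C) := by
    intro n
    induction n with
    | zero =>
      intro s b a
      have := abs_sub (Q₁ s b a) (Q₂ s b a)
      linarith [hC₁ s b a, hC₂ s b a]
    | succ n ih =>
      intro s b a
      have := abs_bellman_sub_bellman_le μ h₁ h₂ ih s b a
      rwa [hQ₁, hQ₂, ← mul_assoc, ← pow_succ'] at this
  funext s b a
  have hlim : Tendsto (fun n : ℕ => M.γ ^ n * (2 * C)) atTop (𝓝 0) := by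
    simpa using (tendsto_pow_atTop_nhds_zero_of_lt_one M.γ_nonneg M.γ_lt_one).mul_const (2 * C)
  have := ge_of_tendsto' hlim fun n => h n s b a
  exact sub_eq_zero.1 (abs_eq_zero.1 (le_antisymm this (abs_nonneg _)))

variable [TopologicalSpace S] [PolishSpace S] [BorelSpace S]
  [TopologicalSpace A] [PolishSpace A] [BorelSpace A]

theorem UpperSemianalytic.integral_section (μ : Kernel S A) [IsMarkovKernel μ]
    {g : S × A → ℝ} (hg : UpperSemianalytic g) {C : ℝ} (hC : ∀ x, |g x| ≤ C) :
    UpperSemianalytic fun s => ∫ a, g (s, a) ∂(μ s) := by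
  have h := hg.integral_kernel (Kernel.id ×ₖ μ) hC
  convert! h using 2 with s
  rw [Kernel.prod_apply, Kernel.id_apply, Measure.dirac_prod, integral_map (by fun_prop)
    (hg.universallyMeasurable.aestronglyMeasurable _)]

theorem IsQFunction.upperSemianalytic_backup (μ : Kernel S A) [IsMarkovKernel μ]
    {Q : S → ℕ → A → ℝ} (hQ : IsQFunction Q) (b : ℕ) :
    UpperSemianalytic fun s => backup μ Q s b := by
  obtain ⟨C, hC⟩ := hQ.bounded
  have hint : ∀ b, UpperSemianalytic fun s => ∫ a, Q s b a ∂(μ s) := fun b =>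
    UpperSemianalytic.integral_section μ (g := fun x : S × A => Q x.1 b x.2)
      (hQ.upperSemianalytic b) (C := C) (fun x => hC _ _ _)
  cases b with
  | zero => exact hint 0
  | succ b =>
    refine UpperSemianalytic.max ?_ (hint _)
    exact UpperSemianalytic.ciSup (g := fun x : S × A => Q x.1 b x.2) (hQ.upperSemianalytic b)
      fun s => ⟨C, by rintro _ ⟨a, rfl⟩; exact (abs_le.1 (hC s b a)).2⟩

theorem IsQFunction.universallyMeasurable {Q : S → ℕ → A → ℝ} (hQ : IsQFunction Q) (b : ℕ) :
    UniversallyMeasurable fun x : S × A => Q x.1 b x.2 :=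
  UpperSemianalytic.universallyMeasurable (hQ.upperSemianalytic b)

theorem IsQFunction.universallyMeasurable_section {Q : S → ℕ → A → ℝ} (hQ : IsQFunction Q) (s : S)
    (b : ℕ) : UniversallyMeasurable (Q s b) :=
  (hQ.universallyMeasurable b).comp (measurable_prodMk_left (x := s)).universallyMeasurable

theorem IsQFunction.inDomain (M : MDP S A) (μ : Kernel S A) [IsMarkovKernel μ]
    {Q : S → ℕ → A → ℝ} (hQ : IsQFunction Q) : InDomain M μ Q where
  bounded := hQ.bounded
  aesm_action s b := (hQ.universallyMeasurable_section s b).aestronglyMeasurable _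
  aesm_state _ b _ :=
    (hQ.upperSemianalytic_backup μ b).universallyMeasurable.aestronglyMeasurable _

theorem isQFunction_bellman (M : MDP S A) (μ : Kernel S A) [IsMarkovKernel μ]
    {Q : S → ℕ → A → ℝ} (hQ : IsQFunction Q) : IsQFunction (bellman M μ Q) where
  bounded := by
    obtain ⟨C, hC⟩ := hQ.bounded
    obtain ⟨R, hR⟩ := M.bounded_reward
    refine ⟨R + M.γ * C, fun s b a => (abs_add_le _ _).trans (add_le_add (hR _) ?_)⟩
    rw [abs_mul, abs_of_nonneg M.γ_nonneg]
    exact mul_le_mul_of_nonneg_left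
      (abs_integral_le_of_abs_le _ fun s => abs_backup_le μ hC s b) M.γ_nonneg
  upperSemianalytic b := by
    obtain ⟨C, hC⟩ := hQ.bounded
    exact M.measurable_reward.upperSemianalytic.add
      (((hQ.upperSemianalytic_backup μ b).integral_kernel M.transition
        (fun s => abs_backup_le μ hC s b)).const_mul M.γ_nonneg)

theorem IsQFunction.integrable_section {Q : S → ℕ → A → ℝ} (hQ : IsQFunction Q) (s : S) (b : ℕ)
    (ν : Measure A) [IsFiniteMeasure ν] : Integrable (Q s b) ν := by
  obtain ⟨C, hC⟩ := hQ.bounded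
  exact (hQ.universallyMeasurable_section s b).integrable (hC s b) ν

theorem IsQFunction.integrable_backup (μ : Kernel S A) [IsMarkovKernel μ] {Q : S → ℕ → A → ℝ}
    (hQ : IsQFunction Q) (b : ℕ) (ν : Measure S) [IsFiniteMeasure ν] :
    Integrable (fun s => backup μ Q s b) ν := by
  obtain ⟨C, hC⟩ := hQ.bounded
  exact (hQ.upperSemianalytic_backup μ b).universallyMeasurable.integrable
    (fun s => abs_backup_le μ hC s b) ν

theorem IsQFunction.integral_le_ciSup {Q : S → ℕ → A → ℝ} (hQ : IsQFunction Q) (s : S) (b : ℕ)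
    (ν : Measure A) [IsProbabilityMeasure ν] : ∫ a, Q s b a ∂ν ≤ ⨆ a, Q s b a := by
  have := integral_mono (hQ.integrable_section s b ν) (integrable_const (⨆ a, Q s b a))
    (le_ciSup (hQ.bddAbove s b))
  simpa using this

/-- Unspent budget is never a disadvantage: monotonicity in the budget is preserved by the
backup. -/
theorem backup_le_backup_succ (μ : Kernel S A) [IsMarkovKernel μ] {Q : S → ℕ → A → ℝ}
    (hQ : IsQFunction Q) (hmono : ∀ s b a, Q s b a ≤ Q s (b + 1) a) (s : S) (b : ℕ) :
    backup μ Q s b ≤ backup μ Q s (b + 1) := by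
  have : Nonempty A := (μ s).nonempty_of_neZero
  refine le_trans ?_ (le_max_left _ _)
  have hint : ∀ b, ∫ a, Q s b a ∂(μ s) ≤ ⨆ a, Q s b a := fun b => hQ.integral_le_ciSup s b _
  cases b with
  | zero => exact hint 0
  | succ b => exact max_le (ciSup_mono (hQ.bddAbove s (b + 1)) fun a => hmono s b a) (hint _)

theorem bellman_le_bellman_succ (M : MDP S A) (μ : Kernel S A) [IsMarkovKernel μ]
    {Q : S → ℕ → A → ℝ} (hQ : IsQFunction Q) (hmono : ∀ s b a, Q s b a ≤ Q s (b + 1) a)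
    (s : S) (b : ℕ) (a : A) : bellman M μ Q s b a ≤ bellman M μ Q s (b + 1) a :=
  add_le_add_right (mul_le_mul_of_nonneg_left (integral_mono (hQ.integrable_backup μ b _)
    (hQ.integrable_backup μ _ _) fun s => backup_le_backup_succ μ hQ hmono s b) M.γ_nonneg) _

/-- The Bellman operator has a fixed point among the upper semianalytic functions, obtained by
iteration from `0`; it is monotone in the budget. -/
theorem exists_bellman_fixedPoint (M : MDP S A) (μ : Kernel S A) [IsMarkovKernel μ] :
    ∃ Q : S → ℕ → A → ℝ, IsQFunction Q ∧ bellman M μ Q = Q ∧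
      ∀ s b a, Q s b a ≤ Q s (b + 1) a := by
  let T := bellman M μ
  let q : ℕ → S → ℕ → A → ℝ := fun n => T^[n] 0
  have hsucc : ∀ n, q (n + 1) = T (q n) := fun n => Function.iterate_succ_apply' T n 0
  have hq : ∀ n, IsQFunction (q n) ∧ ∀ s b a, q n s b a ≤ q n s (b + 1) a := by
    intro n
    induction n with
    | zero =>
      refine ⟨⟨⟨0, fun s b a => by simp [q]⟩, fun b => ?_⟩, fun s b a => le_rfl⟩
      exact UpperSemianalytic.const (X := S × A) 0
    | succ n ih =>
      rw [hsucc]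
      exact ⟨isQFunction_bellman M μ ih.1, bellman_le_bellman_succ M μ ih.1 ih.2⟩
  have hdom : ∀ n, InDomain M μ (q n) := fun n => (hq n).1.inDomain M μ
  obtain ⟨C, hC⟩ := (hq 1).1.bounded
  have hstep : ∀ n s b a, |q (n + 1) s b a - q n s b a| ≤ C * M.γ ^ n := by
    intro n
    induction n with
    | zero => intro s b a; simpa [q] using hC s b a
    | succ n ih =>
      intro s b a
      rw [hsucc (n + 1), hsucc n, pow_succ', mul_left_comm, ← hsucc n]
      nth_rewrite 2 [hsucc n]
      exact abs_bellman_sub_bellman_le μ (hdom _) (hdom _) ih s b a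
  have hdist : ∀ s b a n, dist (q n s b a) (q (n + 1) s b a) ≤ C * M.γ ^ n := fun s b a n => by
    rw [dist_comm]; exact hstep n s b a
  have hlim : ∀ s b a, ∃ l, Tendsto (fun n => q n s b a) atTop (𝓝 l) := fun s b a =>
    cauchySeq_tendsto_of_complete (cauchySeq_of_le_geometric _ _ M.γ_lt_one (hdist s b a))
  choose Q hQ using hlim
  let ε : ℕ → ℝ := fun n => C * M.γ ^ n / (1 - M.γ)
  have hε : Tendsto ε atTop (𝓝 0) := by
    simpa [ε] using ((tendsto_pow_atTop_nhds_zero_of_lt_one M.γ_nonneg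
      M.γ_lt_one).const_mul C).div_const (1 - M.γ)
  have hle : ∀ n s b a, |q n s b a - Q s b a| ≤ ε n := fun n s b a =>
    dist_le_of_le_geometric_of_tendsto _ _ M.γ_lt_one (hdist s b a) (hQ s b a) n
  have hQf : IsQFunction Q := by
    refine ⟨?_, fun b => ?_⟩
    · obtain ⟨C₀, hC₀⟩ := (hq 0).1.bounded
      refine ⟨C₀ + ε 0, fun s b a => ?_⟩
      have := abs_sub_abs_le_abs_sub (Q s b a) (q 0 s b a)
      rw [abs_sub_comm] at this
      linarith [hle 0 s b a, hC₀ s b a]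
    · exact UpperSemianalytic.of_uniform_limit (g := fun n (x : S × A) => q n x.1 b x.2)
        (fun n => (hq n).1.upperSemianalytic b) hε fun n x => hle n _ _ _
  refine ⟨Q, hQf, ?_, fun s b a => le_of_tendsto_of_tendsto' (hQ s b a) (hQ s (b + 1) a)
    fun n => (hq n).2 s b a⟩
  funext s b a
  have h1 : Tendsto (fun n => q (n + 1) s b a) atTop (𝓝 (bellman M μ Q s b a)) := by
    rw [tendsto_iff_dist_tendsto_zero]
    refine squeeze_zero (fun _ => dist_nonneg) (fun n => ?_)
      (by simpa using hε.const_mul M.γ : Tendsto (fun n => M.γ * ε n) atTop (𝓝 0))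
    rw [hsucc]
    exact abs_bellman_sub_bellman_le μ (hdom n) (hQf.inDomain M μ) (hle n) s b a
  exact tendsto_nhds_unique h1 ((tendsto_add_atTop_iff_nat 1).2 (hQ s b a))

end Bellman

/-! ### The laws of the controlled process -/

section ControlledProcess

theorem integral_comp_measure {X Y : Type*} [MeasurableSpace X] [MeasurableSpace Y]
    (κ : Kernel X Y) (ν : Measure X) {f : Y → ℝ} (hf : Integrable f (κ ∘ₘ ν)) :
    ∫ y, f y ∂(κ ∘ₘ ν) = ∫ x, ∫ y, f y ∂(κ x) ∂ν := by
  rw [Measure.comp_eq_comp_const_apply] at hf ⊢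
  rw [Kernel.integral_comp hf, Kernel.const_apply]

theorem integrable_integral_comp_measure {X Y : Type*} [MeasurableSpace X] [MeasurableSpace Y]
    (κ : Kernel X Y) (ν : Measure X) {f : Y → ℝ} (hf : Integrable f (κ ∘ₘ ν)) :
    Integrable (fun x => ∫ y, f y ∂(κ x)) ν := by
  rw [Measure.comp_eq_comp_const_apply] at hf
  simpa using hf.integral_comp

variable {S A : Type*} [MeasurableSpace S] [MeasurableSpace A] [StandardBorelSpace A]

/-- The law of `((s_t, a_t), b_{t+1})` when `((s_0, a_0), b_1)` has law `ρ`. Feasibility and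
expected return depend on the trajectory only through these laws. -/
noncomputable def marginal (M : MDP S A) (μ : Kernel S A) [IsMarkovKernel μ] (π : Policy S A)
    (ρ : Measure ((S × A) × ℤ)) : ℕ → Measure ((S × A) × ℤ)
  | 0 => ρ
  | t + 1 => stepKernel M μ π ∘ₘ marginal M μ π ρ t

instance (M : MDP S A) (μ : Kernel S A) [IsMarkovKernel μ] (π : Policy S A)
    (ρ : Measure ((S × A) × ℤ)) [IsProbabilityMeasure ρ] (t : ℕ) :
    IsProbabilityMeasure (marginal M μ π ρ t) := by
  induction t with
  | zero => assumption
  | succ t ih => rw [marginal]; infer_instance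

instance (M : MDP S A) (μ : Kernel S A) [IsMarkovKernel μ] (π : Policy S A)
    (ρ : Measure ((S × A) × ℤ)) [IsProbabilityMeasure ρ] :
    IsProbabilityMeasure (trajLaw M μ π ρ) := by
  unfold trajLaw
  infer_instance

theorem map_eval_trajLaw (M : MDP S A) (μ : Kernel S A) [IsMarkovKernel μ] (π : Policy S A)
    (ρ : Measure ((S × A) × ℤ)) [IsProbabilityMeasure ρ] (t : ℕ) :
    (trajLaw M μ π ρ).map (fun ω => ω t) = marginal M μ π ρ t := by
  induction t with
  | zero =>
    rw [marginal, trajLaw, Kernel.trajMeasure]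
    have h : (fun ω : ℕ → (S × A) × ℤ => ω 0) =
        (fun h : (i : Finset.Iic 0) → (S × A) × ℤ => h ⟨0, Finset.mem_Iic.2 le_rfl⟩) ∘
          Preorder.frestrictLe (π := fun _ => (S × A) × ℤ) 0 := rfl
    rw [h, ← Measure.map_map (by fun_prop) (by fun_prop), Measure.map_comp _ _ (by fun_prop),
      Kernel.traj_map_frestrictLe, Kernel.partialTraj_self, Measure.id_comp,
      Measure.map_map (by fun_prop) (by fun_prop)]
    exact Measure.map_id
  | succ t ih =>
    have h := congrArg Measure.snd
      (Kernel.map_frestrictLe_trajMeasure_compProd_eq_map_trajMeasure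
        (X := fun _ => (S × A) × ℤ) (μ₀ := ρ) (a := t)
        (κ := fun n => (stepKernel M μ π).comap
          (fun h : (i : Finset.Iic n) → (S × A) × ℤ => h ⟨n, Finset.mem_Iic.2 le_rfl⟩)
          (measurable_pi_apply _)))
    rw [Measure.snd_compProd, Measure.snd_map_prodMk (by fun_prop),
      ← Kernel.comp_deterministic_eq_comap, ← Measure.comp_assoc,
      Measure.deterministic_comp_eq_map, Measure.map_map (by fun_prop) (by fun_prop)] at h
    rw [marginal, ← ih]
    exact h.symm

theorem feasible_iff (M : MDP S A) (μ : Kernel S A) [IsMarkovKernel μ] (π : Policy S A)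
    (ρ : Measure ((S × A) × ℤ)) [IsProbabilityMeasure ρ] :
    Feasible M μ π ρ ↔ ∀ t, ∀ᵐ z ∂(marginal M μ π ρ t), 0 ≤ z.2 := by
  rw [Feasible, ae_all_iff]
  refine forall_congr' fun t => ?_
  have ht : Measurable fun ω : ℕ → (S × A) × ℤ => ω t := measurable_pi_apply t
  rw [← map_eval_trajLaw, ae_map_iff ht.aemeasurable
    (measurableSet_le measurable_const measurable_snd)]

theorem hasSum_expectedReturn (M : MDP S A) (μ : Kernel S A) [IsMarkovKernel μ] (π : Policy S A)
    (ρ : Measure ((S × A) × ℤ)) [IsProbabilityMeasure ρ] :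
    HasSum (fun t => M.γ ^ t * ∫ z, M.reward z.1 ∂(marginal M μ π ρ t))
      (expectedReturn M μ π ρ) := by
  obtain ⟨R, hR⟩ := M.bounded_reward
  have hr : Measurable fun z : (S × A) × ℤ => M.reward z.1 :=
    M.measurable_reward.comp measurable_fst
  have hint : ∀ t, Integrable (fun ω : ℕ → (S × A) × ℤ => M.γ ^ t * M.reward (ω t).1)
      (trajLaw M μ π ρ) := fun t =>
    (Integrable.of_bound (hr.comp (measurable_pi_apply t)).aestronglyMeasurable R
      (Eventually.of_forall fun ω => hR _)).const_mul _
  have hbound : ∀ t, ∫ ω, ‖M.γ ^ t * M.reward (ω t).1‖ ∂(trajLaw M μ π ρ) ≤ M.γ ^ t * R := by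
    intro t
    refine (integral_mono (hint t).norm (integrable_const (M.γ ^ t * R)) fun ω => ?_).trans
      (by simp)
    rw [norm_mul, norm_pow, Real.norm_of_nonneg M.γ_nonneg]
    exact mul_le_mul_of_nonneg_left (hR _) (pow_nonneg M.γ_nonneg _)
  have hsum := hasSum_integral_of_summable_integral_norm hint
    (Summable.of_nonneg_of_le (fun t => integral_nonneg fun _ => norm_nonneg _) hbound
      ((summable_geometric_of_lt_one M.γ_nonneg M.γ_lt_one).mul_right R))
  convert! hsum using 2 with t
  rw [integral_const_mul, ← map_eval_trajLaw, integral_map (measurable_pi_apply t).aemeasurable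
    hr.aestronglyMeasurable]

/-- The law of `((s_0, a_0), b_1)` as a kernel in `s_0`, for a fixed value of `b_0`. -/
noncomputable def startKernel (μ : Kernel S A) [IsMarkovKernel μ] (π : Policy S A) (b : ℤ) :
    Kernel S ((S × A) × ℤ) :=
  (Kernel.id ×ₖ π.kernel.comap (fun s => (s, b)) (by fun_prop)) ×ₖ
    Kernel.deterministic (fun s => nextBudget μ π (s, b))
      ((measurable_nextBudget μ π).comp (by fun_prop))

instance (μ : Kernel S A) [IsMarkovKernel μ] (π : Policy S A) (b : ℤ) :
    IsMarkovKernel (startKernel μ π b) := by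
  unfold startKernel
  infer_instance

theorem startKernel_apply (μ : Kernel S A) [IsMarkovKernel μ] (π : Policy S A) (b : ℤ) (s : S) :
    startKernel μ π b s = startLaw μ π s b := by
  rw [startKernel, startLaw, Kernel.prod_apply, Kernel.prod_apply, Kernel.id_apply,
    Kernel.comap_apply, Kernel.deterministic_apply, Measure.dirac_prod, Measure.prod_dirac,
    Measure.map_map (by fun_prop) (by fun_prop)]
  rfl

instance (μ : Kernel S A) [IsMarkovKernel μ] (π : Policy S A) (s : S) (b : ℤ) :
    IsProbabilityMeasure (startLaw μ π s b) := by
  rw [← startKernel_apply]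
  infer_instance

/-- One step of the process draws the next state from the transition kernel and then restarts the
process from there with the current budget. -/
theorem stepKernel_apply (M : MDP S A) (μ : Kernel S A) [IsMarkovKernel μ] (π : Policy S A)
    (z : (S × A) × ℤ) :
    stepKernel M μ π z = startKernel μ π z.2 ∘ₘ M.transition z.1 := by
  ext E hE
  rw [Measure.bind_apply hE (Kernel.aemeasurable _), stepKernel, Kernel.compProd_apply hE]
  rw [Kernel.lintegral_compProd]
  · refine lintegral_congr fun s => ?_
    rw [startKernel_apply, startLaw, Measure.map_apply (by fun_prop) hE]
    simp only [Kernel.comap_apply, Kernel.deterministic_apply]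
    rw [← lintegral_indicator_one (measurable_prodMk_left.prodMk measurable_const hE)]
    refine lintegral_congr fun a => ?_
    rw [Measure.dirac_apply' _ (measurable_prodMk_left hE)]
    rfl
  · exact Kernel.measurable_kernel_prodMk_left' hE z

end ControlledProcess

/-! ### Comparing returns with a fixed point -/

section Comparison

/-- Telescoping: the one-step inequality `r t + γ q (t + 1) ≤ q t` bounds the discounted sum of
`r` by `q 0`. -/
theorem hasSum_le_of_discounted_step {γ : ℝ} (h0 : 0 ≤ γ) (h1 : γ < 1) {r q : ℕ → ℝ} {C J : ℝ}
    (hq : ∀ t, |q t| ≤ C) (hstep : ∀ t, r t + γ * q (t + 1) ≤ q t)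
    (hJ : HasSum (fun t => γ ^ t * r t) J) : J ≤ q 0 := by
  have hpart : ∀ n, ∑ t ∈ Finset.range n, γ ^ t * r t + γ ^ n * q n ≤ q 0 := by
    intro n
    induction n with
    | zero => simp
    | succ n ih =>
      refine le_trans ?_ ih
      rw [Finset.sum_range_succ, pow_succ]
      have := mul_le_mul_of_nonneg_left (hstep n) (pow_nonneg h0 n)
      linarith
  have hlim : Tendsto (fun n => γ ^ n * q n) atTop (𝓝 0) := by
    refine squeeze_zero_norm (fun n => ?_) (by
      simpa using (tendsto_pow_atTop_nhds_zero_of_lt_one h0 h1).mul_const C :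
        Tendsto (fun n => γ ^ n * C) atTop (𝓝 0))
    rw [norm_mul, norm_pow, Real.norm_of_nonneg h0]
    exact mul_le_mul_of_nonneg_left (hq n) (pow_nonneg h0 n)
  have := hJ.tendsto_sum_nat.add hlim
  rw [add_zero] at this
  exact le_of_tendsto' this hpart

theorem le_hasSum_of_discounted_step {γ : ℝ} (h0 : 0 ≤ γ) (h1 : γ < 1) {r q : ℕ → ℝ} {C J ε : ℝ}
    (hq : ∀ t, |q t| ≤ C) (hstep : ∀ t, q t ≤ r t + γ * (q (t + 1) + ε))
    (hJ : HasSum (fun t => γ ^ t * r t) J) : q 0 - γ * ε / (1 - γ) ≤ J := by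
  -- With the constant `δ`, the sequence `δ - q t` satisfies the reverse inequality for `-r t`.
  set δ := γ * ε / (1 - γ) with hδ
  have hδ' : δ = γ * ε + γ * δ := by
    have : (1 - γ) ≠ 0 := by linarith
    rw [hδ]
    field_simp
    ring
  have := hasSum_le_of_discounted_step h0 h1 (r := fun t => -r t) (q := fun t => δ - q t)
    (C := |δ| + C) (J := -J) (fun t => (abs_sub _ _).trans (by linarith [hq t]))
    (fun t => by linarith [hstep t]) (by simpa using hJ.neg)
  linarith

variable {S A : Type*} [MeasurableSpace S] [MeasurableSpace A]

/-- A function of state, budget and action as a function on the state space of the controlled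
process; negative budgets are read as `0`. -/
def onProcess (Q : S → ℕ → A → ℝ) (z : (S × A) × ℤ) : ℝ := Q z.1.1 z.2.toNat z.1.2

theorem abs_integral_onProcess_le {Q : S → ℕ → A → ℝ} {C : ℝ} (hC : ∀ s b a, |Q s b a| ≤ C)
    (ν : Measure ((S × A) × ℤ)) [IsProbabilityMeasure ν] : |∫ z, onProcess Q z ∂ν| ≤ C :=
  abs_integral_le_of_abs_le ν fun _ => hC _ _ _

theorem MDP.integrable_reward (M : MDP S A) (ν : Measure ((S × A) × ℤ)) [IsFiniteMeasure ν] :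
    Integrable (fun z => M.reward z.1) ν := by
  obtain ⟨R, hR⟩ := M.bounded_reward
  exact (M.measurable_reward.comp measurable_fst).universallyMeasurable.integrable
    (fun z => hR z.1) ν

theorem ae_startLaw_iff (μ : Kernel S A) [IsMarkovKernel μ] (π : Policy S A) (s : S) (b : ℤ)
    {p : (S × A) × ℤ → Prop} (hp : MeasurableSet {z | p z}) :
    (∀ᵐ z ∂(startLaw μ π s b), p z) ↔
      ∀ᵐ a ∂(π.kernel (s, b)), p ((s, a), nextBudget μ π (s, b)) := by
  rw [startLaw, ae_map_iff (by fun_prop) hp]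

theorem nextBudget_nonneg_of_ae_startLaw (μ : Kernel S A) [IsMarkovKernel μ] (π : Policy S A)
    (s : S) (b : ℤ) (h : ∀ᵐ z ∂(startLaw μ π s b), 0 ≤ z.2) : 0 ≤ nextBudget μ π (s, b) := by
  rw [ae_startLaw_iff μ π s b (measurableSet_le measurable_const measurable_snd)] at h
  exact (Filter.eventually_const.1 h)

/-- On the Borel set `G` of states, the policy `π` never overspends and its one-step value is within
`ε` of the backup of `Q`; moreover `π` does not leave `G`, that is, from a state of `G` the next
state lies in `G` almost surely. -/
structure NearOptimalOn (M : MDP S A) (μ : Kernel S A) (Q : S → ℕ → A → ℝ) (ε : ℝ)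
    (π : Policy S A) (G : Set S) : Prop where
  measurableSet : MeasurableSet G
  nextBudget_nonneg : ∀ s ∈ G, ∀ b : ℕ, 0 ≤ nextBudget μ π (s, (b : ℤ))
  absorbing : ∀ s ∈ G, ∀ b : ℕ, ∀ᵐ a ∂(π.kernel (s, (b : ℤ))), M.transition (s, a) Gᶜ = 0
  backup_le : ∀ s ∈ G, ∀ b : ℕ, backup μ Q s b ≤
    ∫ a, Q s (nextBudget μ π (s, (b : ℤ))).toNat a ∂(π.kernel (s, (b : ℤ))) + ε

theorem NearOptimalOn.ae_startLaw {M : MDP S A} {μ : Kernel S A} [IsMarkovKernel μ]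
    {Q : S → ℕ → A → ℝ} {ε : ℝ} {π : Policy S A} {G : Set S} (h : NearOptimalOn M μ Q ε π G)
    {s : S} (hs : s ∈ G) (b : ℕ) :
    ∀ᵐ z ∂(startLaw μ π s b), 0 ≤ z.2 ∧ M.transition z.1 Gᶜ = 0 := by
  rw [ae_startLaw_iff]
  · filter_upwards [h.absorbing s hs b] with a ha
    exact ⟨h.nextBudget_nonneg s hs b, ha⟩
  · exact (measurableSet_le measurable_const measurable_snd).inter
      (measurableSet_eq_fun ((Kernel.measurable_coe _ h.measurableSet.compl).comp measurable_fst)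
        measurable_const)

section StandardBorel

variable [StandardBorelSpace A]

theorem ae_stepKernel_iff (M : MDP S A) (μ : Kernel S A) [IsMarkovKernel μ] (π : Policy S A)
    (z : (S × A) × ℤ) {p : (S × A) × ℤ → Prop} (hp : MeasurableSet {z | p z}) :
    (∀ᵐ z' ∂(stepKernel M μ π z), p z') ↔
      ∀ᵐ s ∂(M.transition z.1), ∀ᵐ z' ∂(startLaw μ π s z.2), p z' := by
  rw [stepKernel_apply, Measure.ae_comp_iff hp]
  simp only [startKernel_apply]

theorem NearOptimalOn.ae_marginal {M : MDP S A} {μ : Kernel S A} [IsMarkovKernel μ]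
    {Q : S → ℕ → A → ℝ} {ε : ℝ} {π : Policy S A} {G : Set S} (h : NearOptimalOn M μ Q ε π G)
    {ρ : Measure ((S × A) × ℤ)} (hρ : ∀ᵐ z ∂ρ, 0 ≤ z.2 ∧ M.transition z.1 Gᶜ = 0) (t : ℕ) :
    ∀ᵐ z ∂(marginal M μ π ρ t), 0 ≤ z.2 ∧ M.transition z.1 Gᶜ = 0 := by
  have hm : MeasurableSet {z : (S × A) × ℤ | 0 ≤ z.2 ∧ M.transition z.1 Gᶜ = 0} :=
    (measurableSet_le measurable_const measurable_snd).inter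
      (measurableSet_eq_fun ((Kernel.measurable_coe _ h.measurableSet.compl).comp measurable_fst)
        measurable_const)
  induction t with
  | zero => exact hρ
  | succ t ih =>
    refine Measure.ae_comp_of_ae_ae hm ?_
    filter_upwards [ih] with z hz
    rw [ae_stepKernel_iff M μ π z hm]
    obtain ⟨x, b⟩ := z
    obtain ⟨hb, hG⟩ := hz
    lift b to ℕ using hb
    filter_upwards [measure_eq_zero_iff_ae_notMem.1 hG] with s hs
    exact h.ae_startLaw (not_not.1 hs) b

theorem NearOptimalOn.feasible {M : MDP S A} {μ : Kernel S A} [IsMarkovKernel μ]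
    {Q : S → ℕ → A → ℝ} {ε : ℝ} {π : Policy S A} {G : Set S} (h : NearOptimalOn M μ Q ε π G)
    {ρ : Measure ((S × A) × ℤ)} [IsProbabilityMeasure ρ]
    (hρ : ∀ᵐ z ∂ρ, 0 ≤ z.2 ∧ M.transition z.1 Gᶜ = 0) : Feasible M μ π ρ :=
  (feasible_iff M μ π ρ).2 fun t => (h.ae_marginal hρ t).mono fun _ hz => hz.1

end StandardBorel

variable [TopologicalSpace S] [PolishSpace S] [BorelSpace S]
  [TopologicalSpace A] [PolishSpace A] [BorelSpace A]

theorem IsQFunction.universallyMeasurable_onProcess {Q : S → ℕ → A → ℝ} (hQ : IsQFunction Q) :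
    UniversallyMeasurable (onProcess Q) := by
  refine UpperSemianalytic.universallyMeasurable (fun c => ?_)
  have : {z | c < onProcess Q z} = ⋃ b : ℤ, Prod.fst ⁻¹' {x : S × A | c < Q x.1 b.toNat x.2} ∩
      Prod.snd ⁻¹' {b} := by
    ext z
    simp [onProcess]
  rw [this]
  refine AnalyticSet.iUnion fun b => AnalyticSet.inter
    ((hQ.upperSemianalytic b.toNat c).preimage continuous_fst) ?_
  exact (isClosed_singleton.preimage continuous_snd).analyticSet

theorem IsQFunction.integrable_onProcess {Q : S → ℕ → A → ℝ} (hQ : IsQFunction Q)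
    (ν : Measure ((S × A) × ℤ)) [IsFiniteMeasure ν] : Integrable (onProcess Q) ν := by
  obtain ⟨C, hC⟩ := hQ.bounded
  exact hQ.universallyMeasurable_onProcess.integrable (fun z => hC _ _ _) ν

theorem IsQFunction.integral_onProcess_startLaw (μ : Kernel S A) [IsMarkovKernel μ]
    {Q : S → ℕ → A → ℝ} (hQ : IsQFunction Q) (π : Policy S A) (s : S) (b : ℤ) :
    ∫ z, onProcess Q z ∂(startLaw μ π s b) =
      ∫ a, Q s (nextBudget μ π (s, b)).toNat a ∂(π.kernel (s, b)) := by
  rw [startLaw, integral_map (by fun_prop)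
    (hQ.universallyMeasurable_onProcess.aestronglyMeasurable _)]
  rfl

/-- If the budget stays non-negative, no choice of an action distribution is better than the
backup: either the behaviour policy is followed at no cost, or one unit is spent. -/
theorem integral_nextBudget_le_backup (μ : Kernel S A) [IsMarkovKernel μ] {Q : S → ℕ → A → ℝ}
    (hQ : IsQFunction Q) (π : Policy S A) (s : S) (b : ℕ)
    (h : 0 ≤ nextBudget μ π (s, (b : ℤ))) :
    ∫ a, Q s (nextBudget μ π (s, (b : ℤ))).toNat a ∂(π.kernel (s, (b : ℤ))) ≤ backup μ Q s b := by
  by_cases heq : π.kernel (s, (b : ℤ)) = μ s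
  · have : nextBudget μ π (s, (b : ℤ)) = b := by simp [nextBudget, heq]
    rw [this, Int.toNat_natCast, heq]
    cases b with
    | zero => exact le_rfl
    | succ b => exact le_max_right _ _
  · have hn : nextBudget μ π (s, (b : ℤ)) = b - 1 := by simp [nextBudget, heq]
    rw [hn] at h ⊢
    cases b with
    | zero => simp at h
    | succ b =>
      have : (((b + 1 : ℕ) : ℤ) - 1).toNat = b := by simp
      rw [this]
      exact (hQ.integral_le_ciSup s b _).trans (le_max_left _ _)

theorem IsQFunction.integral_onProcess_startLaw_le_backup (μ : Kernel S A) [IsMarkovKernel μ]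
    {Q : S → ℕ → A → ℝ} (hQ : IsQFunction Q) (π : Policy S A) (s : S) (b : ℕ)
    (h : ∀ᵐ z ∂(startLaw μ π s b), 0 ≤ z.2) :
    ∫ z, onProcess Q z ∂(startLaw μ π s b) ≤ backup μ Q s b := by
  rw [hQ.integral_onProcess_startLaw μ]
  exact integral_nextBudget_le_backup μ hQ π s b (nextBudget_nonneg_of_ae_startLaw μ π s b h)

theorem IsQFunction.integral_onProcess_stepKernel (M : MDP S A) (μ : Kernel S A) [IsMarkovKernel μ]
    {Q : S → ℕ → A → ℝ} (hQ : IsQFunction Q) (π : Policy S A) (z : (S × A) × ℤ) :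
    ∫ z', onProcess Q z' ∂(stepKernel M μ π z) =
      ∫ s, ∫ z', onProcess Q z' ∂(startLaw μ π s z.2) ∂(M.transition z.1) := by
  rw [stepKernel_apply, integral_comp_measure _ _ (hQ.integrable_onProcess _)]
  simp only [startKernel_apply]

theorem IsQFunction.integrable_integral_startLaw (M : MDP S A) (μ : Kernel S A) [IsMarkovKernel μ]
    {Q : S → ℕ → A → ℝ} (hQ : IsQFunction Q) (π : Policy S A) (z : (S × A) × ℤ) :
    Integrable (fun s => ∫ z', onProcess Q z' ∂(startLaw μ π s z.2)) (M.transition z.1) := by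
  simp only [← startKernel_apply]
  exact integrable_integral_comp_measure _ _ (hQ.integrable_onProcess _)

theorem IsQFunction.integral_marginal_succ (M : MDP S A) (μ : Kernel S A) [IsMarkovKernel μ]
    {Q : S → ℕ → A → ℝ} (hQ : IsQFunction Q) (π : Policy S A) (ρ : Measure ((S × A) × ℤ))
    [IsProbabilityMeasure ρ] (t : ℕ) :
    ∫ z, onProcess Q z ∂(marginal M μ π ρ (t + 1)) =
      ∫ z, ∫ z', onProcess Q z' ∂(stepKernel M μ π z) ∂(marginal M μ π ρ t) := by
  rw [marginal, integral_comp_measure]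
  exact hQ.integrable_onProcess (marginal M μ π ρ (t + 1))

theorem IsQFunction.integrable_integral_stepKernel (M : MDP S A) (μ : Kernel S A)
    [IsMarkovKernel μ] {Q : S → ℕ → A → ℝ} (hQ : IsQFunction Q) (π : Policy S A)
    (ν : Measure ((S × A) × ℤ)) [IsProbabilityMeasure ν] :
    Integrable (fun z => ∫ z', onProcess Q z' ∂(stepKernel M μ π z)) ν :=
  integrable_integral_comp_measure _ _ (hQ.integrable_onProcess _)

/-- The return of a feasible policy is at most the value of a fixed point. -/
theorem expectedReturn_le (M : MDP S A) (μ : Kernel S A) [IsMarkovKernel μ]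
    {Q : S → ℕ → A → ℝ} (hQ : IsQFunction Q) (hfix : bellman M μ Q = Q) (π : Policy S A)
    (ρ : Measure ((S × A) × ℤ)) [IsProbabilityMeasure ρ] (hρ : Feasible M μ π ρ) :
    expectedReturn M μ π ρ ≤ ∫ z, onProcess Q z ∂ρ := by
  rw [feasible_iff] at hρ
  obtain ⟨C, hC⟩ := hQ.bounded
  refine hasSum_le_of_discounted_step M.γ_nonneg M.γ_lt_one
    (q := fun t => ∫ z, onProcess Q z ∂(marginal M μ π ρ t))
    (fun t => abs_integral_onProcess_le hC _) (fun t => ?_) (hasSum_expectedReturn M μ π ρ)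
  have hnext : ∀ᵐ z ∂(marginal M μ π ρ t), ∀ᵐ z' ∂(stepKernel M μ π z), 0 ≤ z'.2 :=
    Measure.ae_ae_of_ae_comp (hρ (t + 1))
  rw [hQ.integral_marginal_succ M μ π, ← integral_const_mul, ← integral_add (M.integrable_reward _)
    ((hQ.integrable_integral_stepKernel M μ π _).const_mul _)]
  refine integral_mono_ae ((M.integrable_reward _).add
    ((hQ.integrable_integral_stepKernel M μ π _).const_mul _)) (hQ.integrable_onProcess _) ?_
  filter_upwards [hρ t, hnext] with z hz hz'
  rw [ae_stepKernel_iff M μ π z (measurableSet_le measurable_const measurable_snd)] at hz'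
  obtain ⟨⟨s, a⟩, b⟩ := z
  lift b to ℕ using hz
  have hval : onProcess Q ((s, a), (b : ℤ)) = bellman M μ Q s b a := by rw [hfix]; rfl
  rw [hval, hQ.integral_onProcess_stepKernel M μ π, bellman]
  refine add_le_add_right (mul_le_mul_of_nonneg_left (integral_mono_ae
    (hQ.integrable_integral_startLaw M μ π _) (hQ.integrable_backup μ b _) ?_) M.γ_nonneg) _
  filter_upwards [hz'] with s' hs'
  exact hQ.integral_onProcess_startLaw_le_backup μ π s' b hs'

/-- A policy that stays in a set on which it is near-optimal loses at most `ε` in every step after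
the first, discounted to a total of `γ ε / (1 - γ)`. -/
theorem NearOptimalOn.le_expectedReturn {M : MDP S A} {μ : Kernel S A} [IsMarkovKernel μ]
    {Q : S → ℕ → A → ℝ} {ε : ℝ} {π : Policy S A} {G : Set S} (h : NearOptimalOn M μ Q ε π G)
    (hQ : IsQFunction Q) (hfix : bellman M μ Q = Q)
    {ρ : Measure ((S × A) × ℤ)} [IsProbabilityMeasure ρ]
    (hρ : ∀ᵐ z ∂ρ, 0 ≤ z.2 ∧ M.transition z.1 Gᶜ = 0) :
    ∫ z, onProcess Q z ∂ρ - M.γ * ε / (1 - M.γ) ≤ expectedReturn M μ π ρ := by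
  obtain ⟨C, hC⟩ := hQ.bounded
  refine le_hasSum_of_discounted_step M.γ_nonneg M.γ_lt_one
    (q := fun t => ∫ z, onProcess Q z ∂(marginal M μ π ρ t))
    (fun t => abs_integral_onProcess_le hC _) (fun t => ?_) (hasSum_expectedReturn M μ π ρ)
  have hi := hQ.integrable_integral_stepKernel M μ π (marginal M μ π ρ t)
  have hiε : Integrable (fun z => ∫ z', onProcess Q z' ∂(stepKernel M μ π z) + ε)
      (marginal M μ π ρ t) := hi.add (integrable_const _)
  have hsplit : ∫ z, onProcess Q z ∂(marginal M μ π ρ (t + 1)) + ε =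
      ∫ z, (∫ z', onProcess Q z' ∂(stepKernel M μ π z) + ε) ∂(marginal M μ π ρ t) := by
    rw [hQ.integral_marginal_succ M μ π, integral_add hi (integrable_const _)]
    simp
  rw [hsplit, ← integral_const_mul, ← integral_add (M.integrable_reward _)
    (hiε.const_mul _)]
  refine integral_mono_ae (hQ.integrable_onProcess _) ((M.integrable_reward _).add
    (hiε.const_mul _)) ?_
  filter_upwards [h.ae_marginal hρ t] with z hz
  obtain ⟨⟨s, a⟩, b⟩ := z
  obtain ⟨hb, hG⟩ := hz
  lift b to ℕ using hb
  have hval : onProcess Q ((s, a), (b : ℤ)) = bellman M μ Q s b a := by rw [hfix]; rfl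
  have hi' := hQ.integrable_integral_startLaw M μ π ((s, a), (b : ℤ))
  have hsplit' : ∫ s', ∫ z', onProcess Q z' ∂(startLaw μ π s' b) ∂(M.transition (s, a)) + ε =
      ∫ s', (∫ z', onProcess Q z' ∂(startLaw μ π s' b) + ε) ∂(M.transition (s, a)) := by
    rw [integral_add hi' (integrable_const _)]
    simp
  simp only [hval, hQ.integral_onProcess_stepKernel M μ π, bellman, hsplit']
  refine add_le_add_right (mul_le_mul_of_nonneg_left (integral_mono_ae
    (hQ.integrable_backup μ b _) (hi'.add (integrable_const _)) ?_) M.γ_nonneg) _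
  filter_upwards [measure_eq_zero_iff_ae_notMem.1 hG] with s' hs'
  simp only [hQ.integral_onProcess_startLaw μ]
  exact h.backup_le s' (not_not.1 hs') b

end Comparison

/-! ### Near-optimal Borel policies -/

section NearOptimal

/-- If countably many kernels map null sets to null sets, every null set is contained in a null set
whose complement is absorbing for all of them. -/
theorem exists_null_absorbing {X : Type*} [MeasurableSpace X] (ν : Measure X)
    (K : ℕ → Kernel X X)
    (hK : ∀ N, MeasurableSet N → ν N = 0 → ∀ b, ∀ᵐ x ∂ν, K b x N = 0)
    {N₀ : Set X} (hN₀ : MeasurableSet N₀) (hν : ν N₀ = 0) :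
    ∃ N, MeasurableSet N ∧ N₀ ⊆ N ∧ ν N = 0 ∧ ∀ x ∉ N, ∀ b, K b x N = 0 := by
  let N : ℕ → Set X := fun n => Nat.rec N₀ (fun _ T => T ∪ ⋃ b, {x | K b x T ≠ 0}) n
  have hsucc : ∀ n, N (n + 1) = N n ∪ ⋃ b, {x | K b x (N n) ≠ 0} := fun _ => rfl
  have hm : ∀ n, MeasurableSet (N n) ∧ ν (N n) = 0 := by
    intro n
    induction n with
    | zero => exact ⟨hN₀, hν⟩
    | succ n ih =>
      rw [hsucc]
      refine ⟨ih.1.union (.iUnion fun b =>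
        (measurableSet_eq_fun ((K b).measurable_coe ih.1) measurable_const).compl),
        measure_union_null ih.2 (measure_iUnion_null fun b => ?_)⟩
      exact hK _ ih.1 ih.2 b
  refine ⟨⋃ n, N n, .iUnion fun n => (hm n).1, subset_iUnion N 0,
    measure_iUnion_null fun n => (hm n).2, fun x hx b => measure_iUnion_null fun n => ?_⟩
  by_contra hne
  refine hx (mem_iUnion.2 ⟨n + 1, ?_⟩)
  rw [hsucc]
  exact Or.inr (mem_iUnion.2 ⟨b, hne⟩)

variable {S A : Type*} [MeasurableSpace S] [MeasurableSpace A]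

/-- The states visited from `ν` when each action is drawn from `μ` or given by one of countably many
universally measurable selectors are all dominated by a single measure `Λ`. Since a selector can be
changed on a null set, it may then be replaced by a Borel function before the policy, and hence the
law of the process, is defined. -/
theorem exists_dominating_measure (M : MDP S A) (μ : Kernel S A) [IsMarkovKernel μ]
    {φ : ℕ → S → A} (hφ : ∀ b, UniversallyMeasurable (φ b)) (ν : Measure S) [SFinite ν] :
    ∃ Λ : Measure S, SFinite Λ ∧ ν ≪ Λ ∧ ∀ N, MeasurableSet N → Λ N = 0 →
      (∀ᵐ s ∂Λ, ∀ᵐ a ∂(μ s), M.transition (s, a) N = 0) ∧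
        ∀ b, ∀ᵐ s ∂Λ, M.transition (s, φ b s) N = 0 := by
  have hφ' : ∀ b (η : Measure S) [SFinite η], AEMeasurable (fun s => (s, φ b s)) η := fun b η _ =>
    aemeasurable_id.prodMk ((hφ b).aemeasurable η)
  obtain ⟨L, hL0, hsucc⟩ : ∃ L : ℕ → Measure S, L 0 = ν ∧ ∀ n, L (n + 1) =
      M.transition ∘ₘ (L n ⊗ₘ μ) +
        Measure.sum fun b => M.transition ∘ₘ ((L n).map fun s => (s, φ b s)) :=
    ⟨fun n => Nat.rec ν (fun _ η => M.transition ∘ₘ (η ⊗ₘ μ) +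
      Measure.sum fun b => M.transition ∘ₘ (η.map fun s => (s, φ b s))) n, rfl, fun _ => rfl⟩
  have hL : ∀ n, SFinite (L n) := by
    intro n
    induction n with
    | zero => rwa [hL0]
    | succ n ih => rw [hsucc]; infer_instance
  refine ⟨Measure.sum L, inferInstance,
    Measure.absolutelyContinuous_sum_right 0 (hL0 ▸ .rfl), fun N hN h0 => ?_⟩
  rw [Measure.sum_apply_eq_zero] at h0
  have hae : ∀ η : Measure (S × A), (M.transition ∘ₘ η) N = 0 →
      ∀ᵐ x ∂η, M.transition x N = 0 := by
    intro η h
    filter_upwards [Measure.ae_ae_of_ae_comp (measure_eq_zero_iff_ae_notMem.1 h)] with x hx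
    exact measure_eq_zero_iff_ae_notMem.2 hx
  have hnext : ∀ n, (M.transition ∘ₘ (L n ⊗ₘ μ)) N = 0 ∧
      ∀ b, (M.transition ∘ₘ ((L n).map fun s => (s, φ b s))) N = 0 := by
    intro n
    have h := h0 (n + 1)
    rw [hsucc, Measure.add_apply, add_eq_zero, Measure.sum_apply_eq_zero] at h
    exact h
  refine ⟨Measure.ae_sum_iff.2 fun n => ?_, fun b => Measure.ae_sum_iff.2 fun n => ?_⟩
  · exact Measure.ae_ae_of_ae_compProd (hae _ (hnext n).1)
  · exact ae_of_ae_map (hφ' b (L n)) (hae _ ((hnext n).2 b))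

/-- A Borel policy that spends a unit of budget in the states of `D b` when `b + 1` units are left,
on the action `φ b s`, and follows the behaviour policy everywhere else. -/
noncomputable def spendingPolicy (μ : Kernel S A) [IsMarkovKernel μ] {φ : ℕ → S → A}
    (hφ : ∀ b, Measurable (φ b)) {D : ℕ → Set S} (hD : ∀ b, MeasurableSet (D b)) : Policy S A := by
  classical
  exact
  { kernel := Kernel.piecewise (s := {x : S × ℤ | 1 ≤ x.2 ∧ x.1 ∈ D (x.2 - 1).toNat})
      (measurableSet_setOfPred.2 (measurable_from_prod_countable_left fun b =>
        measurableSet_setOfPred.1 ((MeasurableSet.const (1 ≤ b)).inter (hD (b - 1).toNat))))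
      (Kernel.deterministic (fun x : S × ℤ => φ (x.2 - 1).toNat x.1)
        (measurable_from_prod_countable_left fun b => hφ (b - 1).toNat))
      (μ.comap Prod.fst measurable_fst)
    markov_kernel := inferInstance }

theorem spendingPolicy_of_mem (μ : Kernel S A) [IsMarkovKernel μ] {φ : ℕ → S → A}
    (hφ : ∀ b, Measurable (φ b)) {D : ℕ → Set S} (hD : ∀ b, MeasurableSet (D b)) {s : S} {b : ℕ}
    (hs : s ∈ D b) :
    (spendingPolicy μ hφ hD).kernel (s, ((b + 1 : ℕ) : ℤ)) = Measure.dirac (φ b s) := by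
  classical
  rw [spendingPolicy, Kernel.piecewise_apply, if_pos, Kernel.deterministic_apply]
  · simp
  · simpa using hs

theorem spendingPolicy_of_notMem (μ : Kernel S A) [IsMarkovKernel μ] {φ : ℕ → S → A}
    (hφ : ∀ b, Measurable (φ b)) {D : ℕ → Set S} (hD : ∀ b, MeasurableSet (D b)) {s : S} {b : ℕ}
    (hs : s ∉ D b) :
    (spendingPolicy μ hφ hD).kernel (s, ((b + 1 : ℕ) : ℤ)) = μ s := by
  classical
  rw [spendingPolicy, Kernel.piecewise_apply, if_neg, Kernel.comap_apply]
  simpa using hs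

theorem spendingPolicy_zero (μ : Kernel S A) [IsMarkovKernel μ] {φ : ℕ → S → A}
    (hφ : ∀ b, Measurable (φ b)) {D : ℕ → Set S} (hD : ∀ b, MeasurableSet (D b)) (s : S) :
    (spendingPolicy μ hφ hD).kernel (s, ((0 : ℕ) : ℤ)) = μ s := by
  classical
  rw [spendingPolicy, Kernel.piecewise_apply, if_neg, Kernel.comap_apply]
  simp

variable [TopologicalSpace A] [PolishSpace A] [BorelSpace A]

/-- For a selector that is within `ε` of the supremum, spending exactly where this beats following
the behaviour policy loses at most `ε` against the backup. If the selected point mass happens to be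
the behaviour policy, nothing is spent, which is no worse by monotonicity in the budget. -/
theorem spendingPolicy_near_optimal (μ : Kernel S A) [IsMarkovKernel μ] {Q : S → ℕ → A → ℝ}
    (hmono : ∀ s b a, Q s b a ≤ Q s (b + 1) a) {ε : ℝ} (hε : 0 ≤ ε) {φ : ℕ → S → A}
    (hφ : ∀ b, Measurable (φ b)) {D : ℕ → Set S} (hD : ∀ b, MeasurableSet (D b)) {s : S}
    (hsel : ∀ b, (⨆ a, Q s b a) - ε ≤ Q s b (φ b s))
    (hspend : ∀ b, s ∈ D b ↔ ∫ a, Q s (b + 1) a ∂(μ s) < ⨆ a, Q s b a) (b : ℕ) :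
    0 ≤ nextBudget μ (spendingPolicy μ hφ hD) (s, (b : ℤ)) ∧ backup μ Q s b ≤
      ∫ a, Q s (nextBudget μ (spendingPolicy μ hφ hD) (s, (b : ℤ))).toNat a
        ∂((spendingPolicy μ hφ hD).kernel (s, (b : ℤ))) + ε := by
  set π := spendingPolicy μ hφ hD with hπ
  have hfollow : ∀ b : ℕ, π.kernel (s, (b : ℤ)) = μ s → nextBudget μ π (s, (b : ℤ)) = b :=
    fun b h => by simp [nextBudget, h]
  cases b with
  | zero =>
    have h := spendingPolicy_zero μ hφ hD s
    rw [hfollow 0 h, hπ, h]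
    exact ⟨le_rfl, by simpa [backup] using hε⟩
  | succ b =>
    by_cases hs : s ∈ D b
    · have h := spendingPolicy_of_mem μ hφ hD hs
      have hV : backup μ Q s (b + 1) = ⨆ a, Q s b a := max_eq_left ((hspend b).1 hs).le
      by_cases heq : π.kernel (s, ((b + 1 : ℕ) : ℤ)) = μ s
      · rw [hfollow _ heq, hπ, h, integral_dirac, hV, Int.toNat_natCast]
        exact ⟨by positivity, by linarith [hsel b, hmono s b (φ b s)]⟩
      · have hn : nextBudget μ π (s, ((b + 1 : ℕ) : ℤ)) = b := by
          rw [nextBudget, if_pos heq]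
          simp
        rw [hn, hπ, h, integral_dirac, hV, Int.toNat_natCast]
        exact ⟨by positivity, by linarith [hsel b]⟩
    · have h := spendingPolicy_of_notMem μ hφ hD hs
      have hV : backup μ Q s (b + 1) = ∫ a, Q s (b + 1) a ∂(μ s) :=
        max_eq_right (not_lt.1 fun hlt => hs ((hspend b).2 hlt))
      rw [hfollow _ h, hπ, h, hV, Int.toNat_natCast]
      exact ⟨by positivity, by linarith⟩

variable [TopologicalSpace S] [PolishSpace S] [BorelSpace S]

/-- Near-optimal policies exist off a null set of any given measure, with any tolerance `ε` that
actions can achieve; `ε = 0` is allowed. -/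
theorem exists_nearOptimalOn [Nonempty A] (M : MDP S A) (μ : Kernel S A) [IsMarkovKernel μ]
    {Q : S → ℕ → A → ℝ} (hQ : IsQFunction Q) (hmono : ∀ s b a, Q s b a ≤ Q s (b + 1) a)
    {ε : ℝ} (hε : 0 ≤ ε) (hsel : ∀ s b, ∃ a, (⨆ a, Q s b a) - ε ≤ Q s b a)
    (ν : Measure S) [SFinite ν] :
    ∃ (π : Policy S A) (G : Set S), NearOptimalOn M μ Q ε π G ∧ ν Gᶜ = 0 := by
  obtain ⟨C, hC⟩ := hQ.bounded
  have hsup : ∀ b, UpperSemianalytic fun s => ⨆ a, Q s b a := fun b =>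
    UpperSemianalytic.ciSup (g := fun x : S × A => Q x.1 b x.2) (hQ.upperSemianalytic b)
      fun s => hQ.bddAbove s b
  have hint : ∀ b, UpperSemianalytic fun s => ∫ a, Q s b a ∂(μ s) := fun b =>
    UpperSemianalytic.integral_section μ (g := fun x : S × A => Q x.1 b x.2)
      (hQ.upperSemianalytic b) (C := C) (fun x => hC _ _ _)
  have hex : ∀ b, ∃ φ : S → A, UniversallyMeasurable φ ∧
      ∀ s, (⨆ a, Q s b a) - ε ≤ Q s b (φ s) := fun b =>
    exists_universallyMeasurable_selector (g := fun x : S × A => Q x.1 b x.2)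
      (hQ.upperSemianalytic b) (v := fun s => (⨆ a, Q s b a) - ε)
      ((hsup b).add (UpperSemianalytic.const (-ε))).universallyMeasurable
      fun s => hsel s b
  choose φ hφ hφsel using hex
  obtain ⟨Λ, hΛ, hνΛ, hnull⟩ := exists_dominating_measure M μ hφ ν
  let ψ : ℕ → S → A := fun b => ((hφ b).aemeasurable Λ).mk
  have hψ : ∀ b, Measurable (ψ b) := fun b => ((hφ b).aemeasurable Λ).measurable_mk
  have hψφ : ∀ b, ∀ᵐ s ∂Λ, φ b s = ψ b s := fun b => ((hφ b).aemeasurable Λ).ae_eq_mk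
  have hspend : ∀ b, NullMeasurableSet {s | ∫ a, Q s (b + 1) a ∂(μ s) < ⨆ a, Q s b a} Λ :=
    fun b => nullMeasurableSet_lt ((hint (b + 1)).universallyMeasurable.aemeasurable Λ)
      ((hsup b).universallyMeasurable.aemeasurable Λ)
  choose D hDsup hD hDae using fun b => (hspend b).exists_measurable_superset_ae_eq
  let π := spendingPolicy μ hψ hD
  have hgood : ∀ᵐ s ∂Λ, ∀ b, φ b s = ψ b s ∧
      (s ∈ D b ↔ ∫ a, Q s (b + 1) a ∂(μ s) < ⨆ a, Q s b a) := by
    rw [ae_all_iff]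
    intro b
    filter_upwards [hψφ b, (hDae b).mem_iff] with s h1 h2
    exact ⟨h1, h2⟩
  let K : ℕ → Kernel S S := fun b => M.transition ∘ₖ
    (Kernel.id ×ₖ π.kernel.comap (fun s => (s, (b : ℤ))) (by fun_prop))
  have hKapply : ∀ b s N, MeasurableSet N →
      (K b s N = 0 ↔ ∀ᵐ a ∂(π.kernel (s, (b : ℤ))), M.transition (s, a) N = 0) := by
    intro b s N hN
    have hm : Measurable fun x => M.transition x N := M.transition.measurable_coe hN
    have h1 : K b s N = ∫⁻ a, M.transition (s, a) N ∂(π.kernel (s, (b : ℤ))) := by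
      simp only [K]
      rw [Kernel.comp_apply' _ _ _ hN, Kernel.prod_apply, Kernel.id_apply, Measure.dirac_prod,
        lintegral_map hm (by fun_prop), Kernel.comap_apply]
    have hms : Measurable fun a => M.transition (s, a) N := hm.comp measurable_prodMk_left
    rw [h1, lintegral_eq_zero_iff hms]
    rfl
  have hKnull : ∀ N, MeasurableSet N → Λ N = 0 → ∀ b, ∀ᵐ s ∂Λ, K b s N = 0 := by
    intro N hN h0 b
    obtain ⟨hμN, hφN⟩ := hnull N hN h0
    have hm : Measurable fun x => M.transition x N := M.transition.measurable_coe hN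
    filter_upwards [hgood, hμN, ae_all_iff.2 hφN] with s hs h1 h2
    rw [hKapply b s N hN]
    cases b with
    | zero => rw [show π.kernel _ = _ from spendingPolicy_zero μ hψ hD s]; exact h1
    | succ b =>
      by_cases hsD : s ∈ D b
      · rw [show π.kernel _ = _ from spendingPolicy_of_mem μ hψ hD hsD, ← (hs b).1, ae_dirac_eq]
        exact h2 b
      · rw [show π.kernel _ = _ from spendingPolicy_of_notMem μ hψ hD hsD]; exact h1
  obtain ⟨N₀, hN₀sub, hN₀, hN₀null⟩ := exists_measurable_superset_of_null (ae_iff.1 hgood)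
  obtain ⟨N, hN, hN₀N, hN0, habs⟩ := exists_null_absorbing Λ K hKnull hN₀ hN₀null
  have hG : ∀ s ∈ Nᶜ, ∀ b, φ b s = ψ b s ∧
      (s ∈ D b ↔ ∫ a, Q s (b + 1) a ∂(μ s) < ⨆ a, Q s b a) := fun s hs => by
    by_contra h
    exact hs (hN₀N (hN₀sub h))
  have hopt : ∀ s ∈ Nᶜ, ∀ b : ℕ, _ := fun s hs b =>
    spendingPolicy_near_optimal μ hmono hε hψ hD (s := s)
      (fun b => by rw [← (hG s hs b).1]; exact hφsel b s) (fun b => (hG s hs b).2) b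
  refine ⟨π, Nᶜ, ⟨hN.compl, fun s hs b => (hopt s hs b).1, fun s hs b => ?_,
    fun s hs b => (hopt s hs b).2⟩, ?_⟩
  · rw [compl_compl]
    exact (hKapply b s N hN).1 (habs s hs b)
  · rw [compl_compl]
    exact hνΛ hN0

end NearOptimal

/-! ### The optimal values -/

section OptimalValues

theorem exists_ciSup_sub_le {ι : Type*} [Nonempty ι] (f : ι → ℝ) {ε : ℝ} (hε : 0 < ε) :
    ∃ i, (⨆ i, f i) - ε ≤ f i := by
  obtain ⟨i, hi⟩ := exists_lt_of_lt_ciSup (show (⨆ i, f i) - ε < ⨆ i, f i by linarith)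
  exact ⟨i, hi.le⟩

variable {S A : Type*} [TopologicalSpace S] [PolishSpace S] [MeasurableSpace S] [BorelSpace S]
  [TopologicalSpace A] [PolishSpace A] [MeasurableSpace A] [BorelSpace A]
  {M : MDP S A} {μ : Kernel S A} [IsMarkovKernel μ] {Q : S → ℕ → A → ℝ}

theorem IsQFunction.le_of_mem_qValues (hQ : IsQFunction Q) (hfix : bellman M μ Q = Q) {s : S}
    {b : ℕ} {a : A} {v : ℝ} (hv : v ∈ qValues M μ s b a) : v ≤ Q s b a := by
  obtain ⟨π, hπ, rfl⟩ := hv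
  simpa [onProcess] using expectedReturn_le M μ hQ hfix π _ hπ

/-- A policy that is near-optimal off a null set of the law of `s_1` comes close to `Q`. -/
theorem IsQFunction.exists_mem_qValues (hQ : IsQFunction Q) (hfix : bellman M μ Q = Q)
    (hmono : ∀ s b a, Q s b a ≤ Q s (b + 1) a) {ε : ℝ} (hε : 0 ≤ ε)
    (hsel : ∀ s b, ∃ a, (⨆ a, Q s b a) - ε ≤ Q s b a) (s : S) (b : ℕ) (a : A) :
    ∃ v ∈ qValues M μ s b a, Q s b a - M.γ * ε / (1 - M.γ) ≤ v := by
  have : Nonempty A := ⟨a⟩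
  obtain ⟨π, G, hG, hν⟩ := exists_nearOptimalOn M μ hQ hmono hε hsel (M.transition (s, a))
  have hρ : ∀ᵐ z ∂(Measure.dirac ((s, a), (b : ℤ))), 0 ≤ z.2 ∧ M.transition z.1 Gᶜ = 0 := by
    rw [ae_dirac_eq]
    exact ⟨by positivity, hν⟩
  exact ⟨_, ⟨π, hG.feasible hρ, rfl⟩, by simpa [onProcess] using hG.le_expectedReturn hQ hfix hρ⟩

theorem IsQFunction.le_of_mem_vValues (hQ : IsQFunction Q) (hfix : bellman M μ Q = Q) {s : S}
    {b : ℕ} {v : ℝ} (hv : v ∈ vValues M μ s b) : v ≤ backup μ Q s b := by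
  obtain ⟨π, hπ, rfl⟩ := hv
  exact (expectedReturn_le M μ hQ hfix π _ hπ).trans
    (hQ.integral_onProcess_startLaw_le_backup μ π s b ((feasible_iff M μ π _).1 hπ 0))

/-- A policy that is near-optimal off a null set of the point mass at `s` comes close to the
backup of `Q` at `s`. -/
theorem IsQFunction.exists_mem_vValues (hQ : IsQFunction Q) (hfix : bellman M μ Q = Q)
    (hmono : ∀ s b a, Q s b a ≤ Q s (b + 1) a) {ε : ℝ} (hε : 0 ≤ ε)
    (hsel : ∀ s b, ∃ a, (⨆ a, Q s b a) - ε ≤ Q s b a) (s : S) (b : ℕ) :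
    ∃ v ∈ vValues M μ s b, backup μ Q s b - ε - M.γ * ε / (1 - M.γ) ≤ v := by
  have : Nonempty A := (μ s).nonempty_of_neZero
  obtain ⟨π, G, hG, hν⟩ := exists_nearOptimalOn M μ hQ hmono hε hsel (Measure.dirac s)
  have hs : s ∈ G := by
    by_contra h
    simp [h, hG.measurableSet.compl] at hν
  have hρ := hG.ae_startLaw hs b
  refine ⟨_, ⟨π, hG.feasible hρ, rfl⟩, ?_⟩
  have h1 := hG.le_expectedReturn hQ hfix hρ
  have h2 := hG.backup_le s hs b
  rw [← hQ.integral_onProcess_startLaw μ π s b] at h2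
  linarith

theorem IsQFunction.isLUB_qValues (hQ : IsQFunction Q) (hfix : bellman M μ Q = Q)
    (hmono : ∀ s b a, Q s b a ≤ Q s (b + 1) a) (s : S) (b : ℕ) (a : A) :
    IsLUB (qValues M μ s b a) (Q s b a) := by
  have : Nonempty A := ⟨a⟩
  have hγ : 0 < 1 - M.γ := by linarith [M.γ_lt_one]
  refine ⟨fun v hv => hQ.le_of_mem_qValues hfix hv, fun u hu => ?_⟩
  refine le_of_forall_pos_le_add fun δ hδ => ?_
  -- With tolerance `δ (1 - γ)` in every step, the total loss is at most `γ δ ≤ δ`.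
  obtain ⟨v, hv, hle⟩ := hQ.exists_mem_qValues hfix hmono (mul_pos hδ hγ).le
    (fun s b => exists_ciSup_sub_le (Q s b) (mul_pos hδ hγ)) s b a
  have hloss : M.γ * (δ * (1 - M.γ)) / (1 - M.γ) = M.γ * δ := by field_simp
  rw [hloss] at hle
  have := hu hv
  nlinarith [M.γ_lt_one]

theorem IsQFunction.isLUB_vValues (hQ : IsQFunction Q) (hfix : bellman M μ Q = Q)
    (hmono : ∀ s b a, Q s b a ≤ Q s (b + 1) a) (s : S) (b : ℕ) :
    IsLUB (vValues M μ s b) (backup μ Q s b) := by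
  have : Nonempty A := (μ s).nonempty_of_neZero
  have hγ : 0 < 1 - M.γ := by linarith [M.γ_lt_one]
  refine ⟨fun v hv => hQ.le_of_mem_vValues hfix hv, fun u hu => ?_⟩
  refine le_of_forall_pos_le_add fun δ hδ => ?_
  -- The first action loses at most `δ (1 - γ)` and all later ones together at most `γ δ`.
  obtain ⟨v, hv, hle⟩ := hQ.exists_mem_vValues hfix hmono (mul_pos hδ hγ).le
    (fun s b => exists_ciSup_sub_le (Q s b) (mul_pos hδ hγ)) s b
  have hloss : M.γ * (δ * (1 - M.γ)) / (1 - M.γ) = M.γ * δ := by field_simp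
  rw [hloss] at hle
  have := hu hv
  linarith

theorem IsQFunction.qStar_eq (hQ : IsQFunction Q) (hfix : bellman M μ Q = Q)
    (hmono : ∀ s b a, Q s b a ≤ Q s (b + 1) a) : QStar M μ = Q := by
  funext s b a
  have h := hQ.isLUB_qValues hfix hmono s b a
  exact h.csSup_eq h.nonempty

theorem IsQFunction.vStar_eq (hQ : IsQFunction Q) (hfix : bellman M μ Q = Q)
    (hmono : ∀ s b a, Q s b a ≤ Q s (b + 1) a) : VStar M μ = backup μ Q := by
  funext s b
  have h := hQ.isLUB_vValues hfix hmono s b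
  exact h.csSup_eq h.nonempty

theorem IsQFunction.isGreatest_qValues (hQ : IsQFunction Q) (hfix : bellman M μ Q = Q)
    (hmono : ∀ s b a, Q s b a ≤ Q s (b + 1) a)
    (hmax : ∀ s b, ∃ a, ∀ a', Q s b a' ≤ Q s b a) (s : S) (b : ℕ) (a : A) :
    IsGreatest (qValues M μ s b a) (Q s b a) := by
  have : Nonempty A := ⟨a⟩
  obtain ⟨v, hv, hle⟩ := hQ.exists_mem_qValues hfix hmono le_rfl
    (fun s b => (hmax s b).imp fun a ha => by simpa using ciSup_le ha) s b a
  refine ⟨?_, fun v hv => hQ.le_of_mem_qValues hfix hv⟩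
  rwa [le_antisymm (by simpa using hle) (hQ.le_of_mem_qValues hfix hv)]

end OptimalValues

end CounterfactualBudget

theorem mainTheorem1 {S A : Type*}
    [TopologicalSpace S] [PolishSpace S] [MeasurableSpace S] [BorelSpace S]
    [TopologicalSpace A] [PolishSpace A] [MeasurableSpace A] [BorelSpace A]
    (M : MDP S A) (μ : Kernel S A) [IsMarkovKernel μ] :
    -- the operator is well defined on the space of Q-functions and maps it to itself
    (∀ Q : S → ℕ → A → ℝ, IsQFunction Q → InDomain M μ Q ∧ IsQFunction (bellman M μ Q)) ∧
    -- it is a `γ`-contraction in the sup norm, wherever it is meaningful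
    (∀ Q₁ Q₂ : S → ℕ → A → ℝ, InDomain M μ Q₁ → InDomain M μ Q₂ →
      supNorm (bellman M μ Q₁ - bellman M μ Q₂) ≤ ENNReal.ofReal M.γ * supNorm (Q₁ - Q₂)) ∧
    -- the suprema that define `Q⋆` and `V⋆` are genuine
    (∀ s b a, IsLUB (qValues M μ s b a) (QStar M μ s b a)) ∧
    (∀ s b, IsLUB (vValues M μ s b) (VStar M μ s b)) ∧
    -- `Q⋆` is a fixed point, and the only one
    IsQFunction (QStar M μ) ∧
    bellman M μ (QStar M μ) = QStar M μ ∧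
    (∀ Q : S → ℕ → A → ℝ, InDomain M μ Q → bellman M μ Q = Q → Q = QStar M μ) ∧
    -- the two equations that link `Q⋆` and `V⋆`
    (∀ s b a, Integrable (fun s' => VStar M μ s' b) (M.transition (s, a)) ∧
      QStar M μ s b a =
        M.reward (s, a) + M.γ * ∫ s', VStar M μ s' b ∂(M.transition (s, a))) ∧
    (∀ s, VStar M μ s 0 = ∫ a, QStar M μ s 0 a ∂(μ s)) ∧
    (∀ s b, VStar M μ s (b + 1) =
      max (⨆ a, QStar M μ s b a) (∫ a, QStar M μ s (b + 1) a ∂(μ s))) ∧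
    -- if the maxima over actions are attained, so are the maxima over policies
    ((∀ s b, ∃ a, ∀ a', QStar M μ s b a' ≤ QStar M μ s b a) →
      ∀ s b a, IsGreatest (qValues M μ s b a) (QStar M μ s b a)) := by
  obtain ⟨Q, hQ, hfix, hmono⟩ := exists_bellman_fixedPoint M μ
  rw [hQ.qStar_eq hfix hmono, hQ.vStar_eq hfix hmono]
  refine ⟨fun Q' hQ' => ⟨hQ'.inDomain M μ, isQFunction_bellman M μ hQ'⟩,
    fun Q₁ Q₂ h₁ h₂ => supNorm_bellman_sub_le μ h₁ h₂,
    hQ.isLUB_qValues hfix hmono, hQ.isLUB_vValues hfix hmono, hQ, hfix,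
    fun Q' hQ' hfix' => eq_of_bellman_eq μ hQ' (hQ.inDomain M μ) hfix' hfix,
    fun s b a => ⟨hQ.integrable_backup μ b _, ?_⟩, fun s => rfl, fun s b => rfl,
    hQ.isGreatest_qValues hfix hmono⟩
  exact (congrFun (congrFun (congrFun hfix s) b) a).symm
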